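/- Let $(\mathcal M,\mathbf g)$ be a smooth vacuum spacetime, that is, a smooth $4$-manifold with a smooth Lorentzian metric of signature $(-,+,+,+)$ and $\mathbf{Ric}=0$, with Levi-Civita connection $\mathbf D$ and curvature $\mathbf R(W,Z,X,Y)=\mathbf g(W,\mathbf D_X\mathbf D_YZ-\mathbf D_Y\mathbf D_XZ-\mathbf D_{[X,Y]}Z)$. Let $\mathcal H\subset\mathcal M$ be a smooth embedded null hypersurface (possibly with boundary), and let $L$ be a smooth, nowhere vanishing null vector field tangent to $\mathcal H$ with $\mathbf D_LL=0$. Let $v$ be a smooth function on $\mathcal H$ whose null lapse $\Omega:=Lv$ is positive and whose level sets $S_v$ are smooth $2$-spheres. Let $\underline L$ be the null vector field along $\mathcal H$ orthogonal to the leaves $S_v$ with $\mathbf g(L,\underline L)=-2$. For vectors $X,Y$ tangent to the leaves set $$\chi(X,Y)=\mathbf g(\mathbf D_XL,Y),\quad \underline\chi(X,Y)=\mathbf g(\mathbf D_X\underline L,Y),\quad \zeta(X)=\tfrac12\mathbf g(\mathbf D_XL,\underline L),\quad \underline\eta(X)=\tfrac12\mathbf g(\mathbf D_L\underline L,X),$$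 $$\rho=\tfrac14\mathbf R(\underline L,L,\underline L,L),\qquad \check\rho=\rho-\tfrac12\,\widehat\chi\cdot\widehat{\underline\chi},$$ where traces $\mathrm{tr}$, trace-free parts $\widehat{\ }$, norms and contractions are taken with respect to the induced metric of the leaves. For a function $f$ on $\mathcal H$ let $\overline f$ be its mean value over the leaf $S_v$ with respect to area. Suppose that the foliation $(S_v)$ is canonical: on every leaf $$\triangle\!\!\!\!/\,\log\Omega=-\mathrm{div}\!\!\!\!/\;\zeta+\check\rho-\overline{\check\rho},\qquad \int_{S_v}\log\Omega=0,$$ where $\triangle\!\!\!\!/$ and $\mathrm{div}\!\!\!\!/$ are the Laplace-Beltrami operator and the divergence of the leaf. Then $\mathrm{tr}\,\underline\chi$ is differentiable on $\mathcal H$ and $$L(\mathrm{tr}\,\underline\chi)+\tfrac12\,\mathrm{tr}\,\chi\,\mathrm{tr}\,\underline\chi=2\,\overline{\check\rho}+2|\underline\eta|^2\qquad\text{on }\mathcal H.$$ -/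

import Mathlib

open Bundle Manifold MeasureTheory
open scoped ContDiff Manifold

noncomputable section

/-- The model space `ℝ⁴` of spacetime. -/
abbrev R4 : Type := EuclideanSpace ℝ (Fin 4)

/-- The standard unit `2`-sphere in `ℝ³`. -/
abbrev S2 : Type := Metric.sphere (0 : EuclideanSpace ℝ (Fin 3)) 1

/-- A smooth Lorentzian metric, of signature `(-,+,+,+)`, on a smooth `4`-manifold `M`. -/
structure LorentzMetric (M : Type*) [TopologicalSpace M] [ChartedSpace R4 M]
    [IsManifold (𝓡 4) ∞ M] where
  inner (x : M) : TangentSpace (𝓡 4) x →L[ℝ] TangentSpace (𝓡 4) x →L[ℝ] ℝ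
  symm (x : M) (u w : TangentSpace (𝓡 4) x) : inner x u w = inner x w u
  signature (x : M) : ∃ b : Module.Basis (Fin 4) ℝ (TangentSpace (𝓡 4) x),
    ∀ i j, inner x (b i) (b j) = if i = j then (if i = 0 then -1 else 1) else 0
  contMDiff : ContMDiff (𝓡 4) ((𝓡 4).prod 𝓘(ℝ, R4 →L[ℝ] R4 →L[ℝ] ℝ)) ∞
    (fun x ↦ TotalSpace.mk' (R4 →L[ℝ] R4 →L[ℝ] ℝ)
      (E := fun x : M ↦ TangentSpace (𝓡 4) x →L[ℝ] TangentSpace (𝓡 4) x →L[ℝ] ℝ) x (inner x))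

namespace LorentzMetric

variable {M : Type*} [TopologicalSpace M] [ChartedSpace R4 M] [IsManifold (𝓡 4) ∞ M]
  (g : LorentzMetric M)

/-- The metric read in the preferred chart `φ` around `x₀`: at `y` in the target of `φ` it is the
bilinear form `(u, w) ↦ g (dφ⁻¹ u) (dφ⁻¹ w)` on `ℝ⁴`. -/
def inChart (x₀ : M) (y : R4) : R4 →L[ℝ] R4 →L[ℝ] ℝ :=
  let A : R4 →L[ℝ] R4 := mfderiv 𝓘(ℝ, R4) (𝓡 4) (extChartAt (𝓡 4) x₀).symm y
  let G : R4 →L[ℝ] R4 →L[ℝ] ℝ := g.inner ((extChartAt (𝓡 4) x₀).symm y)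
  G.bilinearComp A A

/-- The Christoffel symbols of the Levi-Civita connection in the preferred chart around `x₀`, as the
bilinear map `(u, w) ↦ Γᵏᵢⱼ uⁱ wʲ`. It is the vector whose scalar product with any `t` is
`½ (∂ᵤ g(w, t) + ∂_w g(u, t) - ∂ₜ g(u, w))`. -/
def christoffel (x₀ : M) (y u w : R4) : R4 :=
  (g.inChart x₀ y).inverse
    ((1 / 2 : ℝ) • (fderiv ℝ (g.inChart x₀) y u w + fderiv ℝ (g.inChart x₀) y w u
      - ((fderiv ℝ (g.inChart x₀) y).flip u).flip w))

/-- The Riemann curvature `R(u, w) z = D_u D_w z - D_w D_u z - D_[u,w] z` at `x`, the tangent space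
at `x` being identified with `ℝ⁴` by the preferred chart around `x` (as it is in the definition of
`TangentSpace`). -/
def riemann (x : M) (u w z : R4) : R4 :=
  fderiv ℝ (fun y ↦ g.christoffel x y w z) (extChartAt (𝓡 4) x x) u
    - fderiv ℝ (fun y ↦ g.christoffel x y u z) (extChartAt (𝓡 4) x x) w
    + g.christoffel x (extChartAt (𝓡 4) x x) u (g.christoffel x (extChartAt (𝓡 4) x x) w z)
    - g.christoffel x (extChartAt (𝓡 4) x x) w (g.christoffel x (extChartAt (𝓡 4) x x) u z)

/-- The covariant curvature tensor `𝐑(a, b, c, d) = g(a, R(c, d) b)`. -/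
def curv (x : M) (a b c d : TangentSpace (𝓡 4) x) : ℝ :=
  g.inner x a (g.riemann x c d b)

/-- The Ricci tensor `Ric(u, w)`, the trace of `z ↦ R(z, u) w`. -/
def ricci (x : M) (u w : R4) : ℝ :=
  ∑ i : Fin 4, g.riemann x (EuclideanSpace.single i 1) u w i

/-- The Einstein vacuum equations `Ric = 0`. -/
def IsVacuum : Prop := ∀ (x : M) (u w : R4), g.ricci x u w = 0

/-- The covariant derivative `D_X Y` at `q`, for the Levi-Civita connection of `g`, of a vector
field `Y` of `M` defined along a map `ι : H → M`, in the direction `X` tangent to `H`: in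
coordinates, `X(Yᵏ) + Γᵏᵢⱼ (dι X)ⁱ Yʲ`. -/
def covAlong {E : Type*} [NormedAddCommGroup E] [NormedSpace ℝ E] {K : Type*} [TopologicalSpace K]
    (I : ModelWithCorners ℝ E K) {H : Type*} [TopologicalSpace H] [ChartedSpace K H]
    (ι : H → M) (Y : (q : H) → TangentSpace (𝓡 4) (ι q)) (q : H) (X : TangentSpace I q) :
    TangentSpace (𝓡 4) (ι q) :=
  let Ycoord : H → R4 := fun q' ↦
    (trivializationAt R4 (TangentSpace (𝓡 4) : M → Type _) (ι q)
      (⟨ι q', Y q'⟩ : TangentBundle (𝓡 4) M)).2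
  let dY : R4 := mfderiv I 𝓘(ℝ, R4) Ycoord q X
  dY + g.christoffel (ι q) (extChartAt (𝓡 4) (ι q) (ι q)) (mfderiv I (𝓡 4) ι q X) (Y q)

end LorentzMetric

/-- The derivative `X f` at `q` of a scalar function `f` on `H` along a tangent vector `X`. -/
def dirDeriv {E : Type*} [NormedAddCommGroup E] [NormedSpace ℝ E] {K : Type*} [TopologicalSpace K]
    (I : ModelWithCorners ℝ E K) {H : Type*} [TopologicalSpace H] [ChartedSpace K H]
    (f : H → ℝ) (q : H) (X : TangentSpace I q) : ℝ :=
  mfderiv I 𝓘(ℝ, ℝ) f q X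

/-- A null hypersurface of `(M, g)`: an embedded `3`-manifold `H` (possibly with boundary), together
with a smooth tangent vector field `L` that is nowhere zero, orthogonal to `H` (so that `L` is
null, since it is tangent to `H`) and geodesic. -/
structure NullHypersurface {M : Type*} [TopologicalSpace M] [ChartedSpace R4 M]
    [IsManifold (𝓡 4) ∞ M] (g : LorentzMetric M)
    {K : Type*} [TopologicalSpace K] (I : ModelWithCorners ℝ (EuclideanSpace ℝ (Fin 3)) K)
    (H : Type*) [TopologicalSpace H] [ChartedSpace K H] [IsManifold I ∞ H] where
  ι : H → M
  contMDiff_ι : ContMDiff I (𝓡 4) ∞ ι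
  isEmbedding_ι : Topology.IsEmbedding ι
  immersion_ι (q : H) : Function.Injective (mfderiv I (𝓡 4) ι q)
  L (q : H) : TangentSpace I q
  contMDiff_L : ContMDiff I I.tangent ∞ (fun q ↦ (⟨q, L q⟩ : TangentBundle I H))
  L_ne_zero (q : H) : L q ≠ 0
  L_orthogonal (q : H) (X : TangentSpace I q) :
    g.inner (ι q) (mfderiv I (𝓡 4) ι q (L q)) (mfderiv I (𝓡 4) ι q X) = 0
  L_geodesic (q : H) : g.covAlong I ι (fun q' ↦ mfderiv I (𝓡 4) ι q' (L q')) q (L q) = 0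

/-- A foliation of a null hypersurface by the level sets `S_c = {v = c}` of a smooth function `v`
increasing along `L`, the leaves being smooth `2`-spheres, together with its null pair `(L, Lbar)`:
`Lbar` is the null vector field orthogonal to the leaves with `g(L, Lbar) = -2`. The map `param c`
is a smooth parametrisation of the leaf `S_c` by the standard sphere; it is only used to integrate
over `S_c`, and there is no relation between the parametrisations of different leaves. -/
structure NullFoliation {M : Type*} [TopologicalSpace M] [ChartedSpace R4 M]
    [IsManifold (𝓡 4) ∞ M] (g : LorentzMetric M)
    {K : Type*} [TopologicalSpace K] (I : ModelWithCorners ℝ (EuclideanSpace ℝ (Fin 3)) K)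
    (H : Type*) [TopologicalSpace H] [ChartedSpace K H] [IsManifold I ∞ H]
    extends NullHypersurface g I H where
  v : H → ℝ
  contMDiff_v : ContMDiff I 𝓘(ℝ, ℝ) ∞ v
  lapse_pos (q : H) : 0 < dirDeriv I v q (L q)
  param : ℝ → S2 → H
  contMDiff_param (c : ℝ) (hc : c ∈ Set.range v) : ContMDiff (𝓡 2) I ∞ (param c)
  injective_param (c : ℝ) (hc : c ∈ Set.range v) : Function.Injective (param c)
  immersion_param (c : ℝ) (hc : c ∈ Set.range v) (θ : S2) :
    Function.Injective (mfderiv (𝓡 2) I (param c) θ)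
  range_param (c : ℝ) (hc : c ∈ Set.range v) : Set.range (param c) = {q | v q = c}
  Lbar (q : H) : TangentSpace (𝓡 4) (ι q)
  contMDiff_Lbar : ContMDiff I (𝓡 4).tangent ∞ (fun q ↦ (⟨ι q, Lbar q⟩ : TangentBundle (𝓡 4) M))
  Lbar_null (q : H) : g.inner (ι q) (Lbar q) (Lbar q) = 0
  inner_L_Lbar (q : H) : g.inner (ι q) (mfderiv I (𝓡 4) ι q (L q)) (Lbar q) = -2
  Lbar_orthogonal (q : H) (X : TangentSpace I q) (hX : dirDeriv I v q X = 0) :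
    g.inner (ι q) (Lbar q) (mfderiv I (𝓡 4) ι q X) = 0

namespace NullFoliation

variable {M : Type*} [TopologicalSpace M] [ChartedSpace R4 M] [IsManifold (𝓡 4) ∞ M]
  {g : LorentzMetric M}
  {K : Type*} [TopologicalSpace K] {I : ModelWithCorners ℝ (EuclideanSpace ℝ (Fin 3)) K}
  {H : Type*} [TopologicalSpace H] [ChartedSpace K H] [IsManifold I ∞ H]
  (F : NullFoliation g I H)

/-- A vector tangent to `H`, regarded as a vector of `M`. -/
def push (q : H) (X : TangentSpace I q) : TangentSpace (𝓡 4) (F.ι q) :=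
  mfderiv I (𝓡 4) F.ι q X

/-- The spacetime covariant derivative `D_X Y` of a vector field `Y` along `H`. -/
def D (Y : (q : H) → TangentSpace (𝓡 4) (F.ι q)) (q : H) (X : TangentSpace I q) :
    TangentSpace (𝓡 4) (F.ι q) :=
  g.covAlong I F.ι Y q X

/-- The null lapse `Ω = L v`. -/
def lapse (q : H) : ℝ := dirDeriv I F.v q (F.L q)

/-- The metric on `TH`; on vectors tangent to a leaf it is the induced metric of the leaf. -/
def slash (q : H) (X Y : TangentSpace I q) : ℝ :=
  g.inner (F.ι q) (F.push q X) (F.push q Y)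

/-- `(e 0, e 1)` is an orthonormal basis of the tangent space at `q` of the leaf through `q`. -/
def IsFrame (q : H) (e : Fin 2 → TangentSpace I q) : Prop :=
  (∀ A, dirDeriv I F.v q (e A) = 0) ∧ ∀ A B, F.slash q (e A) (e B) = if A = B then 1 else 0

/-- An orthonormal basis `(e₁, e₂)` of the tangent space at `q` of the leaf through `q`. It is used
for contractions only, which do not depend on its choice. -/
def e (q : H) : Fin 2 → TangentSpace I q :=
  Classical.epsilon (F.IsFrame q)

/-- `χ(X, Y) = g(D_X L, Y)`. -/
def chi (q : H) (X Y : TangentSpace I q) : ℝ :=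
  g.inner (F.ι q) (F.D (fun q' ↦ F.push q' (F.L q')) q X) (F.push q Y)

/-- `χ̲(X, Y) = g(D_X Lbar, Y)`. -/
def chibar (q : H) (X Y : TangentSpace I q) : ℝ :=
  g.inner (F.ι q) (F.D F.Lbar q X) (F.push q Y)

/-- `ζ(X) = ½ g(D_X L, Lbar)`. -/
def zeta (q : H) (X : TangentSpace I q) : ℝ :=
  1 / 2 * g.inner (F.ι q) (F.D (fun q' ↦ F.push q' (F.L q')) q X) (F.Lbar q)

/-- `η̲(X) = ½ g(D_L Lbar, X)`. -/
def etabar (q : H) (X : TangentSpace I q) : ℝ :=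
  1 / 2 * g.inner (F.ι q) (F.D F.Lbar q (F.L q)) (F.push q X)

/-- The trace, on the leaf through `q`, of a bilinear form. -/
def tr (T : (q : H) → TangentSpace I q → TangentSpace I q → ℝ) (q : H) : ℝ :=
  ∑ A, T q (F.e q A) (F.e q A)

/-- The trace-free part of a bilinear form on the leaf. -/
def hat (T : (q : H) → TangentSpace I q → TangentSpace I q → ℝ) (q : H)
    (X Y : TangentSpace I q) : ℝ :=
  T q X Y - 1 / 2 * F.tr T q * F.slash q X Y

/-- The scalar product `T · T'` of two bilinear forms on the leaf. -/
def dot₂ (T T' : (q : H) → TangentSpace I q → TangentSpace I q → ℝ) (q : H) : ℝ :=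
  ∑ A, ∑ B, T q (F.e q A) (F.e q B) * T' q (F.e q A) (F.e q B)

/-- The square norm `|ξ|²` of a `1`-form on the leaf. -/
def normSq (ξ : (q : H) → TangentSpace I q → ℝ) (q : H) : ℝ :=
  ∑ A, ξ q (F.e q A) ^ 2

/-- The leaf-tangent vector field dual to a `1`-form on the leaves. -/
def sharp (ξ : (q : H) → TangentSpace I q → ℝ) (q : H) : TangentSpace I q :=
  ∑ A, ξ q (F.e q A) • F.e q A

/-- The induced covariant derivative `∇̸_X W` on the leaves of a leaf-tangent vector field `W`:
the orthogonal projection of `D_X W` to the tangent space of the leaf. -/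
def leafCov (W : (q : H) → TangentSpace I q) (q : H) (X : TangentSpace I q) : TangentSpace I q :=
  ∑ A, g.inner (F.ι q) (F.D (fun q' ↦ F.push q' (W q')) q X) (F.push q (F.e q A)) • F.e q A

/-- The divergence on the leaves of a `1`-form, `div̸ ξ = g̸(∇̸_A ξ♯, e_A)`. -/
def div (ξ : (q : H) → TangentSpace I q → ℝ) (q : H) : ℝ :=
  ∑ A, F.slash q (F.leafCov (F.sharp ξ) q (F.e q A)) (F.e q A)

/-- The Laplace-Beltrami operator of the leaves, `△̸ f = div̸ (df)`. -/
def laplacian (f : H → ℝ) (q : H) : ℝ := F.div (dirDeriv I f) q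

/-- `ρ = ¼ 𝐑(Lbar, L, Lbar, L)`. -/
def rho (q : H) : ℝ :=
  1 / 4 * g.curv (F.ι q) (F.Lbar q) (F.push q (F.L q)) (F.Lbar q) (F.push q (F.L q))

/-- The renormalised component `ρ̌ = ρ - ½ χ̂ · χ̲̂`. -/
def rhoCheck (q : H) : ℝ :=
  F.rho q - 1 / 2 * F.dot₂ (F.hat F.chi) (F.hat F.chibar) q

/-- The ratio, at `θ`, of the area element of the leaf `S_c`, pulled back by `param c`, to the area
element of the round unit sphere: the square root of the quotient of the Gram determinants of the
two metrics in one and the same basis of the tangent space at `θ`. -/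
def areaDensity (c : ℝ) (θ : S2) : ℝ :=
  let b : Fin 2 → TangentSpace (𝓡 2) θ := fun i ↦
    (EuclideanSpace.single i 1 : EuclideanSpace ℝ (Fin 2))
  let d : TangentSpace (𝓡 2) θ → EuclideanSpace ℝ (Fin 3) := fun w ↦
    mfderiv (𝓡 2) 𝓘(ℝ, EuclideanSpace ℝ (Fin 3))
      (fun θ' : S2 ↦ (θ' : EuclideanSpace ℝ (Fin 3))) θ w
  √((Matrix.of fun i j ↦ F.slash (F.param c θ) (mfderiv (𝓡 2) I (F.param c) θ (b i))
        (mfderiv (𝓡 2) I (F.param c) θ (b j))).det /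
    (Matrix.of fun i j ↦ inner ℝ (d (b i)) (d (b j))).det)

/-- The integral of `f` over the leaf `S_c` with respect to its area. -/
def leafIntegral (f : H → ℝ) (c : ℝ) : ℝ :=
  ∫ θ : S2, f (F.param c θ) * F.areaDensity c θ
    ∂((volume : Measure (EuclideanSpace ℝ (Fin 3))).toSphere)

/-- The mean value of `f` on the leaf `S_c`. -/
def leafMean (f : H → ℝ) (c : ℝ) : ℝ :=
  F.leafIntegral f c / F.leafIntegral (fun _ ↦ 1) c

/-- The foliation is canonical: on every leaf `△̸ log Ω = - div̸ ζ + ρ̌ - mean(ρ̌)` and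
`∫ log Ω = 0`. -/
structure IsCanonical : Prop where
  elliptic (q : H) : F.laplacian (fun q' ↦ Real.log (F.lapse q')) q =
    - F.div F.zeta q + F.rhoCheck q - F.leafMean F.rhoCheck (F.v q)
  normalised (c : ℝ) (hc : c ∈ Set.range F.v) :
    F.leafIntegral (fun q ↦ Real.log (F.lapse q)) c = 0

end NullFoliation

end

/-!
Read `H` and `M` in charts and let `e_A` be a smooth orthonormal frame of the leaves. Since
`D_L L = 0`, the vector `D_L Lbar` is tangent to the leaves and equals `2 η̲♯`; and since `f ↦ X f`
is compatible with brackets, applying `[L, e_A]` to `v` gives `η̲ = -ζ - d log Ω`. Commuting `D_L`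
with `D_A` in `L (tr χ̲) = L (∑_A g(D_A Lbar, e_A))` therefore yields
`L (tr χ̲) = 2 div̸ η̲ - χ · χ̲ + 2 |η̲|² + ∑_A g(R(L, e_A) Lbar, e_A)`, where
`div̸ η̲ = -div̸ ζ - △̸ log Ω`. The trace of the curvature in the null frame shows that the last sum
is `2 ρ - Ric(L, Lbar)`. As `χ · χ̲ = χ̂ · χ̲̂ + ½ tr χ tr χ̲`, the right-hand side becomes
`2 (ρ̌ - div̸ ζ - △̸ log Ω) + 2 |η̲|² - ½ tr χ tr χ̲ - Ric(L, Lbar)`, and the first term is twice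
the mean of `ρ̌` for a canonical foliation.
-/

set_option maxSynthPendingDepth 3

noncomputable section

section LeviCivita

variable {F : Type*} [NormedAddCommGroup F] [NormedSpace ℝ F]

lemma minSmoothness_two_le_infty : minSmoothness ℝ 2 ≤ ∞ := by
  simp only [minSmoothness_of_isRCLikeNormedField]
  exact WithTop.coe_le_coe.mpr le_top

/-- `Γ` is the Christoffel symbol, as a bilinear map, of the Levi-Civita connection of the
pseudo-Riemannian metric `G` on the open set `W`. -/
structure IsLeviCivitaOn (G : F → F →L[ℝ] F →L[ℝ] ℝ) (Γ : F → F →L[ℝ] F →L[ℝ] F)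
    (W : Set F) : Prop where
  isOpen : IsOpen W
  contDiffOn_metric : ContDiffOn ℝ ∞ G W
  contDiffOn_symbol : ContDiffOn ℝ ∞ Γ W
  metric_symm {z : F} (hz : z ∈ W) (u w : F) : G z u w = G z w u
  nondegenerate {z : F} (hz : z ∈ W) (u : F) (hu : ∀ w, G z u w = 0) : u = 0
  symbol_symm {z : F} (hz : z ∈ W) (u w : F) : Γ z u w = Γ z w u
  compatible {z : F} (hz : z ∈ W) (u w t : F) :
    fderiv ℝ G z u w t = G z (Γ z u w) t + G z w (Γ z u t)

/-- The curvature `R(u, w) t` at `z` of the connection with symbol `Γ`. -/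
def localRiemann (Γ : F → F →L[ℝ] F →L[ℝ] F) (z u w t : F) : F :=
  fderiv ℝ Γ z u w t - fderiv ℝ Γ z w u t + Γ z u (Γ z w t) - Γ z w (Γ z u t)

/-- The defect in the transformation law of the connection symbols `Γ` and `Γ'` under the change of
coordinates `ψ`. -/
def symbolDefect (Γ Γ' : F → F →L[ℝ] F →L[ℝ] F) (ψ : F → F) (z u w : F) : F :=
  Γ' (ψ z) (fderiv ℝ ψ z u) (fderiv ℝ ψ z w) + fderiv ℝ (fderiv ℝ ψ) z u w - fderiv ℝ ψ z (Γ z u w)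

lemma eq_zero_of_symm_of_skew {α : Type*} {T : α → α → α → ℝ} (hsymm : ∀ u w t, T u w t = T w u t)
    (hskew : ∀ u w t, T u w t = -T u t w) (u w t : α) : T u w t = 0 := by
  linarith [hsymm u w t, hskew w u t, hsymm w t u, hskew t w u, hsymm t u w, hskew u t w]

namespace IsLeviCivitaOn

variable {G G' : F → F →L[ℝ] F →L[ℝ] ℝ} {Γ Γ' : F → F →L[ℝ] F →L[ℝ] F} {W W' : Set F} {z : F}

lemma contDiffAt_metric (h : IsLeviCivitaOn G Γ W) (hz : z ∈ W) : ContDiffAt ℝ ∞ G z :=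
  h.contDiffOn_metric.contDiffAt (h.isOpen.mem_nhds hz)

lemma hasFDerivAt_metric (h : IsLeviCivitaOn G Γ W) (hz : z ∈ W) :
    HasFDerivAt G (fderiv ℝ G z) z :=
  ((h.contDiffAt_metric hz).differentiableAt (by simp)).hasFDerivAt

lemma hasFDerivAt_symbol (h : IsLeviCivitaOn G Γ W) (hz : z ∈ W) :
    HasFDerivAt Γ (fderiv ℝ Γ z) z :=
  ((h.contDiffOn_symbol.contDiffAt (h.isOpen.mem_nhds hz)).differentiableAt (by simp)).hasFDerivAt

lemma fderiv_fderiv_metric (h : IsLeviCivitaOn G Γ W) (hz : z ∈ W) (u w a b : F) :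
    fderiv ℝ (fderiv ℝ G) z u w a b =
      G z (fderiv ℝ Γ z u w a + Γ z u (Γ z w a)) b + G z (Γ z w a) (Γ z u b)
        + G z (Γ z u a) (Γ z w b) + G z a (fderiv ℝ Γ z u w b + Γ z u (Γ z w b)) := by
  have hG₂ : HasFDerivAt (fderiv ℝ G) (fderiv ℝ (fderiv ℝ G) z) z :=
    (((h.contDiffAt_metric hz).fderiv_right (m := ∞) (by simp)).differentiableAt
      (by simp)).hasFDerivAt
  have hG := h.hasFDerivAt_metric hz
  have hΓ (c : F) : HasFDerivAt (fun z' ↦ Γ z' w c) _ z :=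
    ((h.hasFDerivAt_symbol hz).clm_apply (hasFDerivAt_const w z)).clm_apply (hasFDerivAt_const c z)
  have hleft : HasFDerivAt (fun z' ↦ fderiv ℝ G z' w a b) _ z :=
    ((hG₂.clm_apply (hasFDerivAt_const w z)).clm_apply (hasFDerivAt_const a z)).clm_apply
      (hasFDerivAt_const b z)
  have hright : HasFDerivAt (fun z' ↦ G z' (Γ z' w a) b + G z' a (Γ z' w b)) _ z :=
    ((hG.clm_apply (hΓ a)).clm_apply (hasFDerivAt_const b z)).add
      ((hG.clm_apply (hasFDerivAt_const a z)).clm_apply (hΓ b))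
  have hcompat : (fun z' ↦ fderiv ℝ G z' w a b) =ᶠ[nhds z]
      fun z' ↦ G z' (Γ z' w a) b + G z' a (Γ z' w b) := by
    filter_upwards [h.isOpen.mem_nhds hz] with z' hz' using h.compatible hz' w a b
  have := DFunLike.congr_fun (hleft.unique (hright.congr_of_eventuallyEq hcompat)) u
  simp only [ContinuousLinearMap.comp_zero, zero_add, add_apply, ContinuousLinearMap.flip_apply,
    ContinuousLinearMap.comp_apply, map_add, h.compatible hz] at this ⊢
  linarith

lemma metric_localRiemann_skew (h : IsLeviCivitaOn G Γ W) (hz : z ∈ W) (u w a b : F) :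
    G z (localRiemann Γ z u w a) b = -G z (localRiemann Γ z u w b) a := by
  have hsymm : fderiv ℝ (fderiv ℝ G) z u w a b = fderiv ℝ (fderiv ℝ G) z w u a b := by
    rw [((h.contDiffAt_metric hz).isSymmSndFDerivAt minSmoothness_two_le_infty).eq u w]
  rw [h.fderiv_fderiv_metric hz, h.fderiv_fderiv_metric hz] at hsymm
  rw [h.metric_symm hz (localRiemann Γ z u w b) a]
  simp only [localRiemann, map_add, map_sub, add_apply, sub_apply] at hsymm ⊢
  linarith

lemma symbolDefect_symm (h : IsLeviCivitaOn G Γ W) (h' : IsLeviCivitaOn G' Γ' W') {ψ : F → F}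
    (hz : z ∈ W) (hz' : ψ z ∈ W') (hψ : ContDiffAt ℝ ∞ ψ z) (u w : F) :
    symbolDefect Γ Γ' ψ z u w = symbolDefect Γ Γ' ψ z w u := by
  rw [symbolDefect, symbolDefect, h'.symbol_symm hz', h.symbol_symm hz,
    (hψ.isSymmSndFDerivAt minSmoothness_two_le_infty).eq u w]

lemma metric_symbolDefect_skew (h : IsLeviCivitaOn G Γ W) (h' : IsLeviCivitaOn G' Γ' W') {ψ : F → F}
    (hz : z ∈ W) (hz' : ψ z ∈ W') (hψ : ContDiffAt ℝ ∞ ψ z)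
    (hG : ∀ᶠ z₁ in nhds z, ∀ u w, G z₁ u w = G' (ψ z₁) (fderiv ℝ ψ z₁ u) (fderiv ℝ ψ z₁ w))
    (u w t : F) :
    G' (ψ z) (symbolDefect Γ Γ' ψ z u w) (fderiv ℝ ψ z t) =
      -G' (ψ z) (symbolDefect Γ Γ' ψ z u t) (fderiv ℝ ψ z w) := by
  have hψ₁ := (hψ.differentiableAt (by simp)).hasFDerivAt
  have hψ₂ := ((hψ.fderiv_right (m := ∞) (by simp)).differentiableAt (by simp)).hasFDerivAt
  have hleft : HasFDerivAt (fun z₁ ↦ G z₁ w t) _ z :=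
    ((h.hasFDerivAt_metric hz).clm_apply (hasFDerivAt_const w z)).clm_apply (hasFDerivAt_const t z)
  have hright : HasFDerivAt (fun z₁ ↦ G' (ψ z₁) (fderiv ℝ ψ z₁ w) (fderiv ℝ ψ z₁ t)) _ z :=
    (((h'.hasFDerivAt_metric hz').comp z hψ₁).clm_apply
      (hψ₂.clm_apply (hasFDerivAt_const w z))).clm_apply (hψ₂.clm_apply (hasFDerivAt_const t z))
  have hpull : (fun z₁ ↦ G z₁ w t) =ᶠ[nhds z]
      fun z₁ ↦ G' (ψ z₁) (fderiv ℝ ψ z₁ w) (fderiv ℝ ψ z₁ t) := by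
    filter_upwards [hG] with z₁ hz₁ using hz₁ w t
  have := DFunLike.congr_fun (hleft.unique (hright.congr_of_eventuallyEq hpull)) u
  rw [h'.metric_symm hz' (symbolDefect Γ Γ' ψ z u t)]
  simp only [ContinuousLinearMap.comp_zero, zero_add, add_apply, ContinuousLinearMap.flip_apply,
    ContinuousLinearMap.comp_apply, Function.comp_apply, h.compatible hz, h'.compatible hz',
    hG.self_of_nhds] at this
  simp only [symbolDefect, map_add, map_sub, add_apply, sub_apply]
  linarith

lemma symbolDefect_eq_zero (h : IsLeviCivitaOn G Γ W) (h' : IsLeviCivitaOn G' Γ' W') {ψ : F → F}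
    (hz : z ∈ W) (hz' : ψ z ∈ W') (hψ : ContDiffAt ℝ ∞ ψ z)
    (hsurj : Function.Surjective (fderiv ℝ ψ z))
    (hG : ∀ᶠ z₁ in nhds z, ∀ u w, G z₁ u w = G' (ψ z₁) (fderiv ℝ ψ z₁ u) (fderiv ℝ ψ z₁ w))
    (u w : F) :
    symbolDefect Γ Γ' ψ z u w = 0 := by
  refine h'.nondegenerate hz' _ (hsurj.forall.mpr fun t ↦ ?_)
  refine eq_zero_of_symm_of_skew
    (T := fun u w t ↦ G' (ψ z) (symbolDefect Γ Γ' ψ z u w) (fderiv ℝ ψ z t)) (fun u w t ↦ ?_)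
    (h.metric_symbolDefect_skew h' hz hz' hψ hG) u w t
  rw [h.symbolDefect_symm h' hz hz' hψ]

end IsLeviCivitaOn

end LeviCivita

section CovariantDerivativeAlong

variable {E F : Type*} [NormedAddCommGroup E] [NormedSpace ℝ E]
  [NormedAddCommGroup F] [NormedSpace ℝ F]

/-- The covariant derivative `D_X Y` at `y`, for the connection with symbol `Γ`, of a vector field
`Y` along a map `f` defined on the set `U`. -/
def localCov (Γ : F → F →L[ℝ] F →L[ℝ] F) (f : E → F) (U : Set E) (Y : E → F) (y : E) : E →L[ℝ] F :=
  fderivWithin ℝ Y U y + (Γ (f y)).flip (Y y) ∘L fderivWithin ℝ f U y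

variable {G : F → F →L[ℝ] F →L[ℝ] ℝ} {Γ : F → F →L[ℝ] F →L[ℝ] F} {W : Set F}
  {U : Set E} {f : E → F} {Y Z : E → F} {X X' : E → E} {y : E}

lemma localCov_apply (u : E) :
    localCov Γ f U Y y u = fderivWithin ℝ Y U y u + Γ (f y) (fderivWithin ℝ f U y u) (Y y) :=
  rfl

lemma contDiffOn_localCov (hU : UniqueDiffOn ℝ U) (hΓ : ContDiffOn ℝ ∞ Γ W)
    (hfW : Set.MapsTo f U W) (hf : ContDiffOn ℝ ∞ f U) (hY : ContDiffOn ℝ ∞ Y U)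
    (hX : ContDiffOn ℝ ∞ X U) :
    ContDiffOn ℝ ∞ (fun y ↦ localCov Γ f U Y y (X y)) U :=
  ((hY.fderivWithin hU (by simp)).clm_apply hX).add
    (((hΓ.comp hf hfW).clm_apply ((hf.fderivWithin hU (by simp)).clm_apply hX)).clm_apply hY)

lemma localCov_add (hU : UniqueDiffWithinAt ℝ U y) (hY : DifferentiableWithinAt ℝ Y U y)
    (hZ : DifferentiableWithinAt ℝ Z U y) :
    localCov Γ f U (fun y ↦ Y y + Z y) y = localCov Γ f U Y y + localCov Γ f U Z y := by
  ext u
  simp only [localCov_apply, add_apply, fderivWithin_fun_add hU hY hZ, map_add]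
  abel

lemma localCov_const_smul (hU : UniqueDiffWithinAt ℝ U y) (hY : DifferentiableWithinAt ℝ Y U y)
    (c : ℝ) : localCov Γ f U (fun y ↦ c • Y y) y = c • localCov Γ f U Y y := by
  ext u
  simp only [localCov_apply, smul_apply, fderivWithin_fun_const_smul hU hY, map_smul, smul_add]

lemma localCov_congr (h : Set.EqOn Y Z U) (hy : y ∈ U) :
    localCov Γ f U Y y = localCov Γ f U Z y := by
  rw [localCov, localCov, fderivWithin_congr h (h hy), h hy]

namespace IsLeviCivitaOn

lemma fderivWithin_metric (h : IsLeviCivitaOn G Γ W)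
    (hU : UniqueDiffWithinAt ℝ U y) (hfy : f y ∈ W) (hf : DifferentiableWithinAt ℝ f U y)
    (hY : DifferentiableWithinAt ℝ Y U y) (hZ : DifferentiableWithinAt ℝ Z U y) (u : E) :
    fderivWithin ℝ (fun y ↦ G (f y) (Y y) (Z y)) U y u =
      G (f y) (localCov Γ f U Y y u) (Z y) + G (f y) (Y y) (localCov Γ f U Z y u) := by
  have hG : HasFDerivWithinAt (fun y ↦ G (f y)) _ U y :=
    (h.hasFDerivAt_metric hfy).comp_hasFDerivWithinAt y hf.hasFDerivWithinAt
  rw [((hG.clm_apply hY.hasFDerivWithinAt).clm_apply hZ.hasFDerivWithinAt).fderivWithin hU]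
  simp only [localCov_apply, add_apply, ContinuousLinearMap.comp_apply,
    ContinuousLinearMap.flip_apply, map_add, h.compatible hfy]
  ring

lemma localCov_torsion (h : IsLeviCivitaOn G Γ W)
    (hU : UniqueDiffOn ℝ U) (hUi : U ⊆ closure (interior U)) (hy : y ∈ U) (hfy : f y ∈ W)
    (hf : ContDiffOn ℝ ∞ f U) (hX : DifferentiableWithinAt ℝ X U y)
    (hX' : DifferentiableWithinAt ℝ X' U y) :
    localCov Γ f U (fun y ↦ fderivWithin ℝ f U y (X' y)) y (X y)
        - localCov Γ f U (fun y ↦ fderivWithin ℝ f U y (X y)) y (X' y) =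
      fderivWithin ℝ f U y (fderivWithin ℝ X' U y (X y) - fderivWithin ℝ X U y (X' y)) := by
  have hsymm : IsSymmSndFDerivWithinAt ℝ f U y :=
    (hf y hy).isSymmSndFDerivWithinAt minSmoothness_two_le_infty hU (hUi hy) hy
  have hf₂ := ((hf.fderivWithin (m := ∞) hU (by simp)).differentiableOn (by simp) y
    hy).hasFDerivWithinAt
  simp only [localCov_apply]
  rw [(hf₂.clm_apply hX'.hasFDerivWithinAt).fderivWithin (hU y hy),
    (hf₂.clm_apply hX.hasFDerivWithinAt).fderivWithin (hU y hy)]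
  simp only [add_apply, ContinuousLinearMap.comp_apply, ContinuousLinearMap.flip_apply, map_sub]
  rw [hsymm.eq, h.symbol_symm hfy]
  abel

lemma localCov_curvature (h : IsLeviCivitaOn G Γ W)
    (hU : UniqueDiffOn ℝ U) (hUi : U ⊆ closure (interior U)) (hy : y ∈ U) (hfy : f y ∈ W)
    (hf : ContDiffOn ℝ ∞ f U) (hY : ContDiffOn ℝ ∞ Y U)
    (hX : DifferentiableWithinAt ℝ X U y) (hX' : DifferentiableWithinAt ℝ X' U y) :
    localCov Γ f U (fun y ↦ localCov Γ f U Y y (X' y)) y (X y)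
        - localCov Γ f U (fun y ↦ localCov Γ f U Y y (X y)) y (X' y)
        - localCov Γ f U Y y (fderivWithin ℝ X' U y (X y) - fderivWithin ℝ X U y (X' y)) =
      localRiemann Γ (f y) (fderivWithin ℝ f U y (X y)) (fderivWithin ℝ f U y (X' y)) (Y y) := by
  have hsymm {Z : E → F} (hZ : ContDiffOn ℝ ∞ Z U) : IsSymmSndFDerivWithinAt ℝ Z U y :=
    (hZ y hy).isSymmSndFDerivWithinAt minSmoothness_two_le_infty hU (hUi hy) hy
  have hasDeriv {Z : E → F} (hZ : ContDiffOn ℝ ∞ Z U) :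
      HasFDerivWithinAt Z (fderivWithin ℝ Z U y) U y :=
    (hZ.differentiableOn (by simp) y hy).hasFDerivWithinAt
  have hasDeriv₂ {Z : E → F} (hZ : ContDiffOn ℝ ∞ Z U) : HasFDerivWithinAt (fderivWithin ℝ Z U)
      (fderivWithin ℝ (fderivWithin ℝ Z U) U y) U y :=
    ((hZ.fderivWithin (m := ∞) hU (by simp)).differentiableOn (by simp) y hy).hasFDerivWithinAt
  have hΓ : HasFDerivWithinAt (fun y ↦ Γ (f y)) _ U y :=
    (h.hasFDerivAt_symbol hfy).comp_hasFDerivWithinAt y (hasDeriv hf)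
  have fderivWithin_cov {V : E → E} (hV : DifferentiableWithinAt ℝ V U y) :
      fderivWithin ℝ (fun y ↦ fderivWithin ℝ Y U y (V y)
        + Γ (f y) (fderivWithin ℝ f U y (V y)) (Y y)) U y = _ :=
    (((hasDeriv₂ hY).clm_apply hV.hasFDerivWithinAt).add ((hΓ.clm_apply ((hasDeriv₂ hf).clm_apply
      hV.hasFDerivWithinAt)).clm_apply (hasDeriv hY))).fderivWithin (hU y hy)
  simp only [localCov_apply]
  rw [fderivWithin_cov hX, fderivWithin_cov hX']
  simp only [add_apply, ContinuousLinearMap.comp_apply, ContinuousLinearMap.flip_apply, map_sub,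
    map_add, sub_apply, localRiemann]
  rw [(hsymm hf).eq, (hsymm hY).eq]
  abel

end IsLeviCivitaOn

end CovariantDerivativeAlong

section NullFrame

variable {F κ : Type*} [NormedAddCommGroup F] [NormedSpace ℝ F] [DecidableEq κ]

/-- A null frame for the bilinear form `g`: the family `e` is orthonormal, and `l` and `m` are null
vectors orthogonal to it, normalised by `g l m = -2`. -/
structure IsNullFrame (g : F →L[ℝ] F →L[ℝ] ℝ) (e : κ → F) (l m : F) : Prop where
  symm (u w : F) : g u w = g w u
  nondegenerate (u : F) (hu : ∀ w, g u w = 0) : u = 0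
  e_e (A B : κ) : g (e A) (e B) = if A = B then 1 else 0
  e_l (A : κ) : g (e A) l = 0
  e_m (A : κ) : g (e A) m = 0
  l_l : g l l = 0
  m_m : g m m = 0
  l_m : g l m = -2

namespace IsNullFrame

variable {g : F →L[ℝ] F →L[ℝ] ℝ} {e : κ → F} {l m : F}

lemma l_e (h : IsNullFrame g e l m) (A : κ) : g l (e A) = 0 := by rw [h.symm, h.e_l]

lemma m_e (h : IsNullFrame g e l m) (A : κ) : g m (e A) = 0 := by rw [h.symm, h.e_m]

lemma m_l (h : IsNullFrame g e l m) : g m l = -2 := by rw [h.symm, h.l_m]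

lemma linearIndependent [Finite κ] (h : IsNullFrame g e l m) :
    LinearIndependent ℝ (Sum.elim e ![l, m]) := by
  cases nonempty_fintype κ
  refine Fintype.linearIndependent_iff.mpr fun c hc ↦ ?_
  have pairing (w : F) :
      ∑ A, c (.inl A) * g (e A) w + (c (.inr 0) * g l w + c (.inr 1) * g m w) = 0 := by
    simpa using congrArg (g.flip w) hc
  rintro (A | i)
  · simpa [h.e_e, h.l_e, h.m_e] using pairing (e A)
  · fin_cases i
    · simpa [h.e_m, h.l_m, h.m_m] using pairing m
    · simpa [h.e_l, h.l_l, h.m_l] using pairing l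

variable [Fintype κ] [FiniteDimensional ℝ F]

lemma eq_zero_of_orthogonal (h : IsNullFrame g e l m)
    (hF : Module.finrank ℝ F = Fintype.card κ + 2) {u : F} (he : ∀ A, g u (e A) = 0)
    (hl : g u l = 0) (hm : g u m = 0) : u = 0 := by
  let b := basisOfLinearIndependentOfCardEqFinrank' _ h.linearIndependent (by simp [hF])
  have hu : (g u : F →ₗ[ℝ] ℝ) = 0 := by
    refine b.ext ?_
    rintro (A | i)
    · simpa [b] using he A
    · fin_cases i
      · simpa [b] using hl
      · simpa [b] using hm
  exact h.nondegenerate u fun w ↦ DFunLike.congr_fun hu w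

lemma expansion (h : IsNullFrame g e l m) (hF : Module.finrank ℝ F = Fintype.card κ + 2) (u : F) :
    u = ∑ A, g u (e A) • e A - (1 / 2 * g u m) • l - (1 / 2 * g u l) • m := by
  refine sub_eq_zero.mp (h.eq_zero_of_orthogonal hF (fun A ↦ ?_) ?_ ?_)
  · simp [h.e_e, h.l_e, h.m_e]
  · simp only [one_div, map_sub, map_sum, map_smul, sub_apply, sum_apply, smul_apply, h.e_l,
      smul_eq_mul, mul_zero, Finset.sum_const_zero, h.l_l, sub_self, h.m_l, mul_neg,
      sub_neg_eq_add, zero_add]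
    ring
  · simp only [one_div, map_sub, map_sum, map_smul, sub_apply, sum_apply, smul_apply, h.e_m,
      smul_eq_mul, mul_zero, Finset.sum_const_zero, h.l_m, mul_neg, sub_neg_eq_add, zero_add,
      h.m_m, sub_zero]
    ring

lemma expansion_of_orthogonal (h : IsNullFrame g e l m)
    (hF : Module.finrank ℝ F = Fintype.card κ + 2) {u : F} (hl : g u l = 0) (hm : g u m = 0) :
    u = ∑ A, g u (e A) • e A := by
  refine (h.expansion hF u).trans ?_
  rw [hl, hm, mul_zero, zero_smul, zero_smul, sub_zero, sub_zero]

lemma trace_eq (h : IsNullFrame g e l m) (hF : Module.finrank ℝ F = Fintype.card κ + 2)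
    (T : F →ₗ[ℝ] F) :
    LinearMap.trace ℝ F T = ∑ A, g (T (e A)) (e A) - 1 / 2 * g (T l) m - 1 / 2 * g (T m) l := by
  let φ (w : F) : F →ₗ[ℝ] ℝ := (g.flip w : F →ₗ[ℝ] ℝ) ∘ₗ T
  have hT : T = ∑ A, (φ (e A)).smulRight (e A) - (1 / 2 : ℝ) • (φ m).smulRight l
      - (1 / 2 : ℝ) • (φ l).smulRight m := by
    ext u
    rw [h.expansion hF (T u)]
    simp [φ, smul_smul]
  calc LinearMap.trace ℝ F T
      = ∑ A, φ (e A) (e A) - 1 / 2 * φ m l - 1 / 2 * φ l m := by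
        conv_lhs => rw [hT]
        simp only [map_sub, map_sum, map_smul, LinearMap.trace_smulRight, smul_eq_mul]
    _ = _ := rfl

end IsNullFrame

end NullFrame

section LocalNullFoliation

variable {E F : Type*} [NormedAddCommGroup E] [NormedSpace ℝ E]
  [NormedAddCommGroup F] [NormedSpace ℝ F]

/-- A foliated null hypersurface in coordinates, `U` being the coordinate domain of the hypersurface
and `W` that of spacetime: the immersion `f`, a geodesic null generator `L`, a function `v`
increasing along `L`, the null vector field `Lbar` conjugate to `L` and orthogonal to the level sets
of `v`, and an orthonormal frame `e` of the tangent spaces of these level sets. -/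
structure LocalNullFoliation (G : F → F →L[ℝ] F →L[ℝ] ℝ) (Γ : F → F →L[ℝ] F →L[ℝ] F) (W : Set F)
    (U : Set E) (κ : Type*) [Fintype κ] [DecidableEq κ] where
  f : E → F
  L : E → E
  Lbar : E → F
  v : E → ℝ
  e : κ → E → E
  leviCivita : IsLeviCivitaOn G Γ W
  finrank_eq : Module.finrank ℝ F = Fintype.card κ + 2
  uniqueDiffOn : UniqueDiffOn ℝ U
  subset_closure_interior : U ⊆ closure (interior U)
  mapsTo : Set.MapsTo f U W
  contDiffOn_f : ContDiffOn ℝ ∞ f U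
  contDiffOn_L : ContDiffOn ℝ ∞ L U
  contDiffOn_Lbar : ContDiffOn ℝ ∞ Lbar U
  contDiffOn_v : ContDiffOn ℝ ∞ v U
  contDiffOn_e (A : κ) : ContDiffOn ℝ ∞ (e A) U
  injective {y : E} (hy : y ∈ U) : Function.Injective (fderivWithin ℝ f U y)
  L_orthogonal {y : E} (hy : y ∈ U) (X : E) :
    G (f y) (fderivWithin ℝ f U y (L y)) (fderivWithin ℝ f U y X) = 0
  geodesic {y : E} (hy : y ∈ U) :
    localCov Γ f U (fun y ↦ fderivWithin ℝ f U y (L y)) y (L y) = 0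
  Lbar_Lbar {y : E} (hy : y ∈ U) : G (f y) (Lbar y) (Lbar y) = 0
  L_Lbar {y : E} (hy : y ∈ U) : G (f y) (fderivWithin ℝ f U y (L y)) (Lbar y) = -2
  e_Lbar {y : E} (hy : y ∈ U) (A : κ) : G (f y) (fderivWithin ℝ f U y (e A y)) (Lbar y) = 0
  e_e {y : E} (hy : y ∈ U) (A B : κ) :
    G (f y) (fderivWithin ℝ f U y (e A y)) (fderivWithin ℝ f U y (e B y)) = if A = B then 1 else 0
  v_e {y : E} (hy : y ∈ U) (A : κ) : fderivWithin ℝ v U y (e A y) = 0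
  lapse_pos {y : E} (hy : y ∈ U) : 0 < fderivWithin ℝ v U y (L y)

namespace LocalNullFoliation

variable {κ : Type*} [Fintype κ] [DecidableEq κ] {G : F → F →L[ℝ] F →L[ℝ] ℝ}
  {Γ : F → F →L[ℝ] F →L[ℝ] F} {W : Set F} {U : Set E} (N : LocalNullFoliation G Γ W U κ)

/-- The inclusion of the tangent space of the hypersurface into that of spacetime. -/
abbrev push (y : E) : E →L[ℝ] F := fderivWithin ℝ N.f U y

/-- The generator `L` as a spacetime vector field along the hypersurface. -/
abbrev pushL (y : E) : F := N.push y (N.L y)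

/-- The leaf frame `e` as a family of spacetime vector fields along the hypersurface. -/
abbrev pushE (A : κ) (y : E) : F := N.push y (N.e A y)

/-- The spacetime covariant derivative `X ↦ D_X Y` of a vector field `Y` along the hypersurface. -/
abbrev cov (Y : E → F) (y : E) : E →L[ℝ] F := localCov Γ N.f U Y y

/-- The components `χ_AB = g(D_A L, e_B)`. -/
def chi (A B : κ) (y : E) : ℝ := G (N.f y) (N.cov N.pushL y (N.e A y)) (N.pushE B y)

/-- The components `χ̲_AB = g(D_A Lbar, e_B)`. -/
def chibar (A B : κ) (y : E) : ℝ := G (N.f y) (N.cov N.Lbar y (N.e A y)) (N.pushE B y)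

/-- The components `ζ_A = ½ g(D_A L, Lbar)`. -/
def zeta (A : κ) (y : E) : ℝ := 1 / 2 * G (N.f y) (N.cov N.pushL y (N.e A y)) (N.Lbar y)

/-- The components `η̲_A = ½ g(D_L Lbar, e_A)`. -/
def etabar (A : κ) (y : E) : ℝ := 1 / 2 * G (N.f y) (N.cov N.Lbar y (N.L y)) (N.pushE A y)

/-- The components `g(D_L e_A, e_B)` of the rotation of the leaf frame along `L`. -/
def rotation (A B : κ) (y : E) : ℝ := G (N.f y) (N.cov (N.pushE A) y (N.L y)) (N.pushE B y)

/-- The null lapse `Ω = L v`. -/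
def lapse (y : E) : ℝ := fderivWithin ℝ N.v U y (N.L y)

/-- The components `e_A (log Ω)`. -/
def dlogLapse (A : κ) (y : E) : ℝ := fderivWithin ℝ (fun y ↦ Real.log (N.lapse y)) U y (N.e A y)

/-- The Lie bracket `[L, e_A]`. -/
def bracket (A : κ) (y : E) : E :=
  fderivWithin ℝ (N.e A) U y (N.L y) - fderivWithin ℝ N.L U y (N.e A y)

/-- The spacetime vector field `ξ_A e_A` dual to the leaf `1`-form with components `ξ_A`. -/
def sharp (ξ : κ → E → ℝ) (y : E) : F := ∑ A, ξ A y • N.pushE A y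

/-- The divergence on the leaves of the `1`-form with components `ξ_A`. -/
def div (ξ : κ → E → ℝ) (y : E) : ℝ :=
  ∑ A, G (N.f y) (N.cov (N.sharp ξ) y (N.e A y)) (N.pushE A y)

variable {X X' : E → E} {Y Z : E → F} {ξ ξ' : κ → E → ℝ} {y : E}

lemma contDiffOn_push (hX : ContDiffOn ℝ ∞ X U) : ContDiffOn ℝ ∞ (fun y ↦ N.push y (X y)) U :=
  (N.contDiffOn_f.fderivWithin N.uniqueDiffOn (by simp)).clm_apply hX

lemma contDiffOn_pushL : ContDiffOn ℝ ∞ N.pushL U := N.contDiffOn_push N.contDiffOn_L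

lemma contDiffOn_pushE (A : κ) : ContDiffOn ℝ ∞ (N.pushE A) U :=
  N.contDiffOn_push (N.contDiffOn_e A)

lemma contDiffOn_cov (hY : ContDiffOn ℝ ∞ Y U) (hX : ContDiffOn ℝ ∞ X U) :
    ContDiffOn ℝ ∞ (fun y ↦ N.cov Y y (X y)) U :=
  contDiffOn_localCov N.uniqueDiffOn N.leviCivita.contDiffOn_symbol N.mapsTo N.contDiffOn_f hY hX

lemma contDiffOn_metric (hY : ContDiffOn ℝ ∞ Y U) (hZ : ContDiffOn ℝ ∞ Z U) :
    ContDiffOn ℝ ∞ (fun y ↦ G (N.f y) (Y y) (Z y)) U :=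
  ((N.leviCivita.contDiffOn_metric.comp N.contDiffOn_f N.mapsTo).clm_apply hY).clm_apply hZ

lemma contDiffOn_chibar (A B : κ) : ContDiffOn ℝ ∞ (N.chibar A B) U :=
  N.contDiffOn_metric (N.contDiffOn_cov N.contDiffOn_Lbar (N.contDiffOn_e A)) (N.contDiffOn_pushE B)

lemma contDiffOn_zeta (A : κ) : ContDiffOn ℝ ∞ (N.zeta A) U :=
  contDiffOn_const.mul (N.contDiffOn_metric
    (N.contDiffOn_cov N.contDiffOn_pushL (N.contDiffOn_e A)) N.contDiffOn_Lbar)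

lemma contDiffOn_etabar (A : κ) : ContDiffOn ℝ ∞ (N.etabar A) U :=
  contDiffOn_const.mul (N.contDiffOn_metric
    (N.contDiffOn_cov N.contDiffOn_Lbar N.contDiffOn_L) (N.contDiffOn_pushE A))

lemma contDiffOn_log_lapse : ContDiffOn ℝ ∞ (fun y ↦ Real.log (N.lapse y)) U :=
  ((N.contDiffOn_v.fderivWithin N.uniqueDiffOn (by simp)).clm_apply N.contDiffOn_L).log
    fun _ hy ↦ (N.lapse_pos hy).ne'

lemma contDiffOn_dlogLapse (A : κ) : ContDiffOn ℝ ∞ (N.dlogLapse A) U :=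
  (N.contDiffOn_log_lapse.fderivWithin N.uniqueDiffOn (by simp)).clm_apply (N.contDiffOn_e A)

lemma contDiffOn_sharp (hξ : ∀ A, ContDiffOn ℝ ∞ (ξ A) U) : ContDiffOn ℝ ∞ (N.sharp ξ) U :=
  ContDiffOn.sum fun A _ ↦ (hξ A).smul (N.contDiffOn_pushE A)

lemma metric_symm (hy : y ∈ U) (u w : F) : G (N.f y) u w = G (N.f y) w u :=
  N.leviCivita.metric_symm (N.mapsTo hy) u w

lemma fderivWithin_metric (hY : ContDiffOn ℝ ∞ Y U) (hZ : ContDiffOn ℝ ∞ Z U) (hy : y ∈ U) (u : E) :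
    fderivWithin ℝ (fun y ↦ G (N.f y) (Y y) (Z y)) U y u =
      G (N.f y) (N.cov Y y u) (Z y) + G (N.f y) (Y y) (N.cov Z y u) :=
  N.leviCivita.fderivWithin_metric (N.uniqueDiffOn y hy) (N.mapsTo hy)
    (N.contDiffOn_f.differentiableOn (by simp) y hy) (hY.differentiableOn (by simp) y hy)
    (hZ.differentiableOn (by simp) y hy) u

lemma metric_cov_of_const (hY : ContDiffOn ℝ ∞ Y U) (hZ : ContDiffOn ℝ ∞ Z U) {c : ℝ}
    (hc : ∀ y ∈ U, G (N.f y) (Y y) (Z y) = c) (hy : y ∈ U) (u : E) :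
    G (N.f y) (N.cov Y y u) (Z y) = -G (N.f y) (N.cov Z y u) (Y y) := by
  have hconst : fderivWithin ℝ (fun y ↦ G (N.f y) (Y y) (Z y)) U y u = 0 := by
    rw [fderivWithin_congr (f := fun _ ↦ c) hc (hc y hy), fderivWithin_fun_const]
    rfl
  rw [N.fderivWithin_metric hY hZ hy] at hconst
  rw [N.metric_symm hy (N.cov Z y u)]
  exact eq_neg_of_add_eq_zero_left hconst

lemma push_bracket (hy : y ∈ U) (A : κ) :
    N.push y (N.bracket A y) = N.cov (N.pushE A) y (N.L y) - N.cov N.pushL y (N.e A y) :=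
  (N.leviCivita.localCov_torsion N.uniqueDiffOn N.subset_closure_interior hy (N.mapsTo hy)
    N.contDiffOn_f (N.contDiffOn_L.differentiableOn (by simp) y hy)
    ((N.contDiffOn_e A).differentiableOn (by simp) y hy)).symm

lemma chi_symm (hy : y ∈ U) (A B : κ) : N.chi A B y = N.chi B A y := by
  have chi_eq (A B : κ) :
      N.chi A B y = -G (N.f y) (N.cov (N.pushE B) y (N.e A y)) (N.pushL y) :=
    N.metric_cov_of_const N.contDiffOn_pushL (N.contDiffOn_pushE B)
      (fun y hy ↦ N.L_orthogonal hy _) hy _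
  rw [chi_eq, chi_eq, neg_inj, ← sub_eq_zero, ← sub_apply, ← map_sub,
    N.leviCivita.localCov_torsion N.uniqueDiffOn N.subset_closure_interior hy (N.mapsTo hy)
      N.contDiffOn_f ((N.contDiffOn_e A).differentiableOn (by simp) y hy)
      ((N.contDiffOn_e B).differentiableOn (by simp) y hy),
    N.metric_symm hy, N.L_orthogonal hy]

lemma rotation_skew (hy : y ∈ U) (A B : κ) : N.rotation A B y = -N.rotation B A y :=
  N.metric_cov_of_const (N.contDiffOn_pushE A) (N.contDiffOn_pushE B)
    (fun _ hy ↦ N.e_e hy A B) hy (N.L y)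

lemma isNullFrame (hy : y ∈ U) :
    IsNullFrame (G (N.f y)) (fun A ↦ N.pushE A y) (N.pushL y) (N.Lbar y) where
  symm := N.metric_symm hy
  nondegenerate := N.leviCivita.nondegenerate (N.mapsTo hy)
  e_e := N.e_e hy
  e_l A := by rw [N.metric_symm hy, N.L_orthogonal hy]
  e_m := N.e_Lbar hy
  l_l := N.L_orthogonal hy _
  m_m := N.Lbar_Lbar hy
  l_m := N.L_Lbar hy

lemma expansion (hy : y ∈ U) (u : F) :
    u = ∑ A, G (N.f y) u (N.pushE A y) • N.pushE A y - (1 / 2 * G (N.f y) u (N.Lbar y)) • N.pushL y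
      - (1 / 2 * G (N.f y) u (N.pushL y)) • N.Lbar y :=
  have : FiniteDimensional ℝ F := .of_finrank_pos (by simp [N.finrank_eq])
  (N.isNullFrame hy).expansion N.finrank_eq u

lemma cov_Lbar_L (hy : y ∈ U) : N.cov N.Lbar y (N.L y) = (2 : ℝ) • N.sharp N.etabar y := by
  have Lbar_comp : G (N.f y) (N.cov N.Lbar y (N.L y)) (N.Lbar y) = 0 :=
    self_eq_neg.mp (N.metric_cov_of_const N.contDiffOn_Lbar N.contDiffOn_Lbar
      (fun _ hy ↦ N.Lbar_Lbar hy) hy (N.L y))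
  have L_comp : G (N.f y) (N.cov N.Lbar y (N.L y)) (N.pushL y) = 0 := by
    have := N.metric_cov_of_const N.contDiffOn_pushL N.contDiffOn_Lbar
      (fun _ hy ↦ N.L_Lbar hy) hy (N.L y)
    rwa [N.geodesic hy, map_zero, zero_apply, zero_eq_neg] at this
  rw [N.expansion hy (N.cov N.Lbar y (N.L y)), Lbar_comp, L_comp]
  simp [sharp, etabar, Finset.smul_sum, smul_smul]

lemma cov_pushE_L (hy : y ∈ U) (A : κ) :
    N.cov (N.pushE A) y (N.L y) =
      ∑ B, N.rotation A B y • N.pushE B y + N.etabar A y • N.pushL y := by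
  have L_comp : G (N.f y) (N.cov (N.pushE A) y (N.L y)) (N.pushL y) = 0 := by
    have := N.metric_cov_of_const N.contDiffOn_pushL (N.contDiffOn_pushE A)
      (fun _ hy ↦ N.L_orthogonal hy _) hy (N.L y)
    rwa [N.geodesic hy, map_zero, zero_apply, zero_eq_neg] at this
  have Lbar_comp : G (N.f y) (N.cov (N.pushE A) y (N.L y)) (N.Lbar y) = -2 * N.etabar A y := by
    rw [N.metric_cov_of_const (N.contDiffOn_pushE A) N.contDiffOn_Lbar
      (fun _ hy ↦ N.e_Lbar hy A) hy, etabar]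
    ring
  rw [N.expansion hy (N.cov (N.pushE A) y (N.L y)), L_comp, Lbar_comp]
  simp only [mul_zero, zero_smul, sub_zero, rotation]
  module

lemma bracket_eq (hy : y ∈ U) (A : κ) :
    N.bracket A y = ∑ B, (N.rotation A B y - N.chi A B y) • N.e B y
      + (N.etabar A y + N.zeta A y) • N.L y := by
  apply N.injective hy
  have hchi := N.expansion hy (N.cov N.pushL y (N.e A y))
  have L_comp : G (N.f y) (N.cov N.pushL y (N.e A y)) (N.pushL y) = 0 :=
    self_eq_neg.mp (N.metric_cov_of_const N.contDiffOn_pushL N.contDiffOn_pushL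
      (fun _ hy ↦ N.L_orthogonal hy _) hy (N.e A y))
  rw [L_comp, mul_zero, zero_smul, sub_zero] at hchi
  rw [N.push_bracket hy, N.cov_pushE_L hy, hchi]
  simp only [map_add, map_sub, map_sum, map_smul, sub_smul, Finset.sum_sub_distrib, chi, zeta]
  module

lemma fderivWithin_v_bracket (hy : y ∈ U) (A : κ) :
    fderivWithin ℝ N.v U y (N.bracket A y) = -fderivWithin ℝ N.lapse U y (N.e A y) := by
  have hsymm : IsSymmSndFDerivWithinAt ℝ N.v U y := (N.contDiffOn_v y hy).isSymmSndFDerivWithinAt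
    minSmoothness_two_le_infty N.uniqueDiffOn (N.subset_closure_interior hy) hy
  have hdv := ((N.contDiffOn_v.fderivWithin (m := ∞) N.uniqueDiffOn (by simp)).differentiableOn
    (by simp) y hy).hasFDerivWithinAt
  have hlapse := (hdv.clm_apply
    (N.contDiffOn_L.differentiableOn (by simp) y hy).hasFDerivWithinAt).fderivWithin
      (N.uniqueDiffOn y hy)
  have hve := (hdv.clm_apply
    ((N.contDiffOn_e A).differentiableOn (by simp) y hy).hasFDerivWithinAt).fderivWithin
      (N.uniqueDiffOn y hy)
  rw [fderivWithin_congr (f := fun _ ↦ 0) (fun y hy ↦ N.v_e hy A) (N.v_e hy A),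
    fderivWithin_fun_const] at hve
  replace hve := DFunLike.congr_fun hve (N.L y)
  change _ = -fderivWithin ℝ (fun y ↦ fderivWithin ℝ N.v U y (N.L y)) U y (N.e A y)
  rw [hlapse]
  simp only [bracket, map_sub, Pi.zero_apply, zero_apply, add_apply,
    ContinuousLinearMap.comp_apply, ContinuousLinearMap.flip_apply] at hve ⊢
  rw [hsymm.eq (N.e A y)]
  linarith

lemma etabar_eq (hy : y ∈ U) (A : κ) :
    N.etabar A y = -1 * (N.zeta A y + N.dlogLapse A y) := by
  have hv := N.fderivWithin_v_bracket hy A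
  simp only [N.bracket_eq hy, map_add, map_sum, map_smul, N.v_e hy, mul_zero,
    Finset.sum_const_zero, zero_add, smul_eq_mul] at hv
  change _ * N.lapse y = _ at hv
  have hpos : 0 < N.lapse y := N.lapse_pos hy
  have hlapse : DifferentiableWithinAt ℝ N.lapse U y :=
    ((N.contDiffOn_v.fderivWithin (m := ∞) N.uniqueDiffOn (by simp)).clm_apply
      N.contDiffOn_L).differentiableOn (by simp) y hy
  rw [dlogLapse, (hlapse.hasFDerivWithinAt.log hpos.ne').fderivWithin (N.uniqueDiffOn y hy),
    smul_apply, smul_eq_mul]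
  field_simp
  linarith

lemma div_congr (h : ∀ A, Set.EqOn (ξ A) (ξ' A) U) (hy : y ∈ U) : N.div ξ y = N.div ξ' y := by
  have hsharp : Set.EqOn (N.sharp ξ) (N.sharp ξ') U := fun y hy ↦ by simp only [sharp, h _ hy]
  simp only [div, cov, localCov_congr hsharp hy]

lemma div_add (hξ : ∀ A, ContDiffOn ℝ ∞ (ξ A) U) (hξ' : ∀ A, ContDiffOn ℝ ∞ (ξ' A) U)
    (hy : y ∈ U) : N.div (fun A y ↦ ξ A y + ξ' A y) y = N.div ξ y + N.div ξ' y := by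
  have hsharp : N.sharp (fun A y ↦ ξ A y + ξ' A y) = fun y ↦ N.sharp ξ y + N.sharp ξ' y := by
    funext y
    simp only [sharp, add_smul, Finset.sum_add_distrib]
  simp only [div, cov, hsharp]
  rw [localCov_add (N.uniqueDiffOn y hy) ((N.contDiffOn_sharp hξ).differentiableOn (by simp) y hy)
    ((N.contDiffOn_sharp hξ').differentiableOn (by simp) y hy)]
  simp only [add_apply, map_add, Finset.sum_add_distrib]

lemma div_const_mul (hξ : ∀ A, ContDiffOn ℝ ∞ (ξ A) U) (c : ℝ) (hy : y ∈ U) :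
    N.div (fun A y ↦ c * ξ A y) y = c * N.div ξ y := by
  have hsharp : N.sharp (fun A y ↦ c * ξ A y) = fun y ↦ c • N.sharp ξ y := by
    funext y
    simp only [sharp, Finset.smul_sum, smul_smul]
  simp only [div, cov, hsharp]
  rw [localCov_const_smul (N.uniqueDiffOn y hy)
    ((N.contDiffOn_sharp hξ).differentiableOn (by simp) y hy)]
  simp only [smul_apply, map_smul, smul_eq_mul, Finset.mul_sum]

lemma div_etabar (hy : y ∈ U) : N.div N.etabar y = -N.div N.zeta y - N.div N.dlogLapse y := by
  rw [N.div_congr (fun A y hy ↦ N.etabar_eq hy A) hy,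
    N.div_const_mul (fun A ↦ (N.contDiffOn_zeta A).add (N.contDiffOn_dlogLapse A)) _ hy,
    N.div_add N.contDiffOn_zeta N.contDiffOn_dlogLapse hy]
  ring

lemma metric_cov_cov_Lbar_L (hy : y ∈ U) (u : E) (w : F) :
    G (N.f y) (N.cov (fun y ↦ N.cov N.Lbar y (N.L y)) y u) w =
      2 * G (N.f y) (N.cov (N.sharp N.etabar) y u) w := by
  rw [cov, localCov_congr (fun _ hy ↦ N.cov_Lbar_L hy) hy, localCov_const_smul (N.uniqueDiffOn y hy)
    ((N.contDiffOn_sharp N.contDiffOn_etabar).differentiableOn (by simp) y hy)]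
  simp only [smul_apply, map_smul, smul_eq_mul]

lemma metric_cov_Lbar_bracket (hy : y ∈ U) (A : κ) :
    G (N.f y) (N.cov N.Lbar y (N.bracket A y)) (N.pushE A y) =
      ∑ B, (N.rotation A B y - N.chi A B y) * N.chibar B A y
        + 2 * (N.etabar A y + N.zeta A y) * N.etabar A y := by
  have hL : G (N.f y) (N.cov N.Lbar y (N.L y)) (N.pushE A y) = 2 * N.etabar A y := by
    rw [etabar]
    ring
  rw [N.bracket_eq hy]
  simp only [map_add, map_sum, map_smul, add_apply, sum_apply, smul_apply, smul_eq_mul, hL, chibar]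
  ring

lemma metric_cov_Lbar_cov_pushE (hy : y ∈ U) (A : κ) :
    G (N.f y) (N.cov N.Lbar y (N.e A y)) (N.cov (N.pushE A) y (N.L y)) =
      ∑ B, N.rotation A B y * N.chibar A B y - 2 * N.zeta A y * N.etabar A y := by
  have hL : G (N.f y) (N.cov N.Lbar y (N.e A y)) (N.pushL y) = -2 * N.zeta A y := by
    have := N.metric_cov_of_const N.contDiffOn_pushL N.contDiffOn_Lbar
      (fun _ hy ↦ N.L_Lbar hy) hy (N.e A y)
    rw [zeta, this]
    ring
  rw [N.cov_pushE_L hy]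
  simp only [map_add, map_sum, map_smul, smul_eq_mul, hL, chibar]
  ring

lemma fderivWithin_chibar (hy : y ∈ U) (A : κ) :
    fderivWithin ℝ (N.chibar A A) U y (N.L y) =
      2 * G (N.f y) (N.cov (N.sharp N.etabar) y (N.e A y)) (N.pushE A y)
        + G (N.f y) (localRiemann Γ (N.f y) (N.pushL y) (N.pushE A y) (N.Lbar y)) (N.pushE A y)
        + ∑ B, (N.rotation A B y * (N.chibar A B y + N.chibar B A y)
          - N.chi A B y * N.chibar B A y)
        + 2 * N.etabar A y ^ 2 := by
  have hcurv := congrArg (G (N.f y) · (N.pushE A y)) (N.leviCivita.localCov_curvature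
    N.uniqueDiffOn N.subset_closure_interior hy (N.mapsTo hy) N.contDiffOn_f N.contDiffOn_Lbar
    (N.contDiffOn_L.differentiableOn (by simp) y hy)
    ((N.contDiffOn_e A).differentiableOn (by simp) y hy))
  simp only [map_sub, sub_apply] at hcurv
  rw [← hcurv, show fderivWithin ℝ (N.chibar A A) U y (N.L y) = _ from N.fderivWithin_metric
      (N.contDiffOn_cov N.contDiffOn_Lbar (N.contDiffOn_e A)) (N.contDiffOn_pushE A) hy (N.L y),
    N.metric_cov_Lbar_cov_pushE hy]
  have hbracket := N.metric_cov_Lbar_bracket hy A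
  have hDD := N.metric_cov_cov_Lbar_L hy (N.e A y) (N.pushE A y)
  simp only [bracket, map_sub, sub_apply] at hbracket
  rw [hDD]
  simp only [sub_mul, mul_add, Finset.sum_add_distrib, Finset.sum_sub_distrib] at hbracket ⊢
  linarith

lemma transport_tr_chibar (hy : y ∈ U) :
    fderivWithin ℝ (fun y ↦ ∑ A, N.chibar A A y) U y (N.L y) =
      2 * N.div N.etabar y
        + ∑ A, G (N.f y) (localRiemann Γ (N.f y) (N.pushL y) (N.pushE A y) (N.Lbar y)) (N.pushE A y)
        - ∑ A, ∑ B, N.chi A B y * N.chibar A B y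
        + 2 * ∑ A, N.etabar A y ^ 2 := by
  have rotation_terms :
      ∑ A, ∑ B, N.rotation A B y * (N.chibar A B y + N.chibar B A y) = 0 := by
    refine self_eq_neg.mp (Finset.sum_comm.trans ?_)
    simp only [← Finset.sum_neg_distrib]
    refine Finset.sum_congr rfl fun A _ ↦ Finset.sum_congr rfl fun B _ ↦ ?_
    rw [N.rotation_skew hy B A]
    ring
  have chi_terms : ∑ A, ∑ B, N.chi A B y * N.chibar B A y =
      ∑ A, ∑ B, N.chi A B y * N.chibar A B y := by
    rw [Finset.sum_comm]
    simp only [N.chi_symm hy]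
  rw [fderivWithin_fun_sum (N.uniqueDiffOn y hy) fun A _ ↦
    (N.contDiffOn_chibar A A).differentiableOn (by simp) y hy]
  simp only [sum_apply, N.fderivWithin_chibar hy, Finset.sum_add_distrib, Finset.sum_sub_distrib,
    rotation_terms, chi_terms, div, Finset.mul_sum]
  ring

end LocalNullFoliation

end LocalNullFoliation

section ChartDomain

variable {E : Type*} [NormedAddCommGroup E] [NormedSpace ℝ E] {K : Type*} [TopologicalSpace K]
  {I : ModelWithCorners ℝ E K} {H : Type*} [TopologicalSpace H] [ChartedSpace K H]
  {q₀ q₁ q : H} {U : Set E}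

/-- `U` is a relatively open subset of the target of the preferred chart around `q₀`. -/
structure IsChartDomain (I : ModelWithCorners ℝ E K) (q₀ : H) (U : Set E) : Prop where
  subset_target : U ⊆ (extChartAt I q₀).target
  mem_nhdsWithin {y : E} (hy : y ∈ U) : U ∈ nhdsWithin y (Set.range I)

namespace IsChartDomain

lemma subset_range (hU : IsChartDomain I q₀ U) : U ⊆ Set.range I :=
  hU.subset_target.trans (extChartAt_target_subset_range q₀)

lemma uniqueDiffOn (hU : IsChartDomain I q₀ U) : UniqueDiffOn ℝ U := fun y hy ↦
  (I.uniqueDiffOn y (hU.subset_range hy)).mono_nhds (nhdsWithin_le_iff.mpr (hU.mem_nhdsWithin hy))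

lemma subset_closure_interior (hU : IsChartDomain I q₀ U) : U ⊆ closure (interior U) := by
  intro y hy
  obtain ⟨O, hO, hyO, hOU⟩ := _root_.mem_nhdsWithin.mp (hU.mem_nhdsWithin hy)
  have hsub : O ∩ interior (Set.range I) ⊆ interior U :=
    interior_maximal ((Set.inter_subset_inter_right O interior_subset).trans hOU)
      (hO.inter isOpen_interior)
  exact closure_mono hsub (hO.inter_closure
    ⟨hyO, I.range_subset_closure_interior (hU.subset_range hy)⟩)

lemma preimage_mem_nhds (hU : IsChartDomain I q₀ U) (hq : q ∈ (extChartAt I q₀).source)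
    (hqU : extChartAt I q₀ q ∈ U) : extChartAt I q₀ ⁻¹' U ∈ nhds q := by
  have htendsto : Filter.Tendsto (extChartAt I q₀) (nhds q)
      (nhdsWithin (extChartAt I q₀ q) (Set.range I)) :=
    tendsto_nhdsWithin_iff.mpr ⟨continuousAt_extChartAt' hq,
      Filter.Eventually.of_forall fun q' ↦ by simp [extChartAt]⟩
  exact htendsto (hU.mem_nhdsWithin hqU)

lemma eventually_mem (hU : IsChartDomain I q₀ U) (hq : q ∈ (extChartAt I q₀).source)
    (hqU : extChartAt I q₀ q ∈ U) :
    ∀ᶠ q' in nhds q, q' ∈ (extChartAt I q₀).source ∧ extChartAt I q₀ q' ∈ U :=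
  Filter.inter_mem (extChartAt_source_mem_nhds' hq) (hU.preimage_mem_nhds hq hqU)

end IsChartDomain

section CoordChange

variable [IsManifold I 1 H]

lemma tangentCoordChange_leftInverse (h₀ : q ∈ (extChartAt I q₀).source)
    (h₁ : q ∈ (extChartAt I q₁).source) :
    Function.LeftInverse (tangentCoordChange I q₁ q₀ q) (tangentCoordChange I q₀ q₁ q) :=
  fun v ↦ by rw [tangentCoordChange_comp ⟨⟨h₀, h₁⟩, h₀⟩, tangentCoordChange_self h₀]

lemma mfderiv_extChartAt_eq_tangentCoordChange (hq : q ∈ (extChartAt I q₀).source) :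
    mfderiv I 𝓘(ℝ, E) (extChartAt I q₀) q = tangentCoordChange I q q₀ q := by
  have hq' : q ∈ (chartAt K q₀).source := by rwa [← extChartAt_source I]
  rw [← TangentBundle.continuousLinearMapAt_trivializationAt hq',
    TangentBundle.continuousLinearMapAt_trivializationAt_eq_core hq']

lemma IsChartDomain.hasMFDerivAt (hU : IsChartDomain I q₀ U) {V : Type*} [NormedAddCommGroup V]
    [NormedSpace ℝ V] {h : H → V} {h' : E → V} (hq : q ∈ (extChartAt I q₀).source)
    (hqU : extChartAt I q₀ q ∈ U) (hd : DifferentiableWithinAt ℝ h' U (extChartAt I q₀ q))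
    (heq : ∀ᶠ q' in nhds q, h q' = h' (extChartAt I q₀ q')) :
    HasMFDerivAt I 𝓘(ℝ, V) h q
      (fderivWithin ℝ h' U (extChartAt I q₀ q) ∘L tangentCoordChange I q q₀ q : E →L[ℝ] V) := by
  have hq' : q ∈ (chartAt K q₀).source := by rwa [← extChartAt_source I]
  have hh' : HasMFDerivWithinAt 𝓘(ℝ, E) 𝓘(ℝ, V) h' U (extChartAt I q₀ q) _ :=
    hd.hasFDerivWithinAt.hasMFDerivWithinAt
  have hchart : HasMFDerivAt I 𝓘(ℝ, E) (extChartAt I q₀) q _ :=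
    (mdifferentiableAt_extChartAt hq').hasMFDerivAt
  have hcomp := (hh'.comp q hchart.hasMFDerivWithinAt subset_rfl).hasMFDerivAt
    (hU.preimage_mem_nhds hq hqU)
  rw [mfderiv_extChartAt_eq_tangentCoordChange hq] at hcomp
  exact hcomp.congr_of_eventuallyEq heq

end CoordChange

end ChartDomain

namespace LorentzMetric

variable {M : Type*} [TopologicalSpace M] [ChartedSpace R4 M] [IsManifold (𝓡 4) ∞ M]
  (g : LorentzMetric M)

lemma contMDiffOn_mfderiv_extChartAt_symm (x₀ : M) (u : R4) :
    ContMDiffOn 𝓘(ℝ, R4) (𝓡 4).tangent ∞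
      (fun y ↦ (⟨(extChartAt (𝓡 4) x₀).symm y,
        mfderiv 𝓘(ℝ, R4) (𝓡 4) (extChartAt (𝓡 4) x₀).symm y u⟩ : TangentBundle (𝓡 4) M))
      (extChartAt (𝓡 4) x₀).target := by
  have ho : IsOpen (extChartAt (𝓡 4) x₀).target := isOpen_extChartAt_target x₀
  have htangent := (contMDiffOn_extChartAt_symm (n := ∞) (I := 𝓡 4)
    x₀).contMDiffOn_tangentMapWithin (m := ∞) (by simp) ho.uniqueMDiffOn
  have hconst : ContMDiff 𝓘(ℝ, R4) 𝓘(ℝ, R4).tangent ∞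
      (fun y ↦ (⟨y, u⟩ : TangentBundle 𝓘(ℝ, R4) R4)) :=
    contMDiff_vectorSpace_iff_contDiff.mpr contDiff_const
  refine (htangent.comp hconst.contMDiffOn fun y hy ↦ hy).congr fun y hy ↦ ?_
  simp only [Function.comp, tangentMapWithin]
  rw [mfderivWithin_of_isOpen ho hy]

lemma contDiffOn_inChart (x₀ : M) :
    ContDiffOn ℝ ∞ (g.inChart x₀) (extChartAt (𝓡 4) x₀).target := by
  refine contDiffOn_clm_apply.mpr fun u ↦ contDiffOn_clm_apply.mpr fun w ↦ ?_
  have hg := g.contMDiff.comp_contMDiffOn (contMDiffOn_extChartAt_symm x₀)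
  have hguw := ContMDiffOn.clm_bundle_apply₂ (E₃ := fun _ : M ↦ ℝ) (F₃ := ℝ) (IB := 𝓡 4)
    (ψ := fun y ↦ g.inner ((extChartAt (𝓡 4) x₀).symm y)) hg
    (contMDiffOn_mfderiv_extChartAt_symm x₀ u) (contMDiffOn_mfderiv_extChartAt_symm x₀ w)
  rw [← contMDiffOn_iff_contDiffOn]
  exact fun y hy ↦ (contMDiffWithinAt_totalSpace.mp (hguw y hy)).2

lemma eq_zero_of_forall_inner (x : M) (u : TangentSpace (𝓡 4) x) (hu : ∀ w, g.inner x u w = 0) :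
    u = 0 := by
  obtain ⟨b, hb⟩ := g.signature x
  have hrepr (j) : b.repr u j = 0 := by
    have hj := hu (b j)
    rw [← b.sum_repr u, map_sum, sum_apply] at hj
    simp only [map_smul, smul_apply, hb, smul_eq_mul, mul_ite, mul_zero,
      Finset.sum_ite_eq', Finset.mem_univ, if_true] at hj
    split_ifs at hj <;> linarith
  rw [← b.sum_repr u]
  simp [hrepr]

lemma mfderiv_extChartAt_symm (x₀ : M) {y : R4} (hy : y ∈ (extChartAt (𝓡 4) x₀).target) :
    mfderiv 𝓘(ℝ, R4) (𝓡 4) (extChartAt (𝓡 4) x₀).symm y =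
      tangentCoordChange (𝓡 4) x₀ ((extChartAt (𝓡 4) x₀).symm y)
        ((extChartAt (𝓡 4) x₀).symm y) := by
  have hp : (extChartAt (𝓡 4) x₀).symm y ∈ (chartAt R4 x₀).source := by
    rw [← extChartAt_source (𝓡 4)]
    exact (extChartAt (𝓡 4) x₀).map_target hy
  have hsymm := TangentBundle.symmL_trivializationAt (I := 𝓡 4) hp
  rw [TangentBundle.symmL_trivializationAt_eq_core hp, (extChartAt (𝓡 4) x₀).right_inv hy,
    ModelWithCorners.range_eq_univ] at hsymm
  rw [← mfderivWithin_univ]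
  exact hsymm.symm

variable (x₀ x₁ : M) {p : M}

lemma inChart_apply (hp : p ∈ (extChartAt (𝓡 4) x₀).source) (u w : R4) :
    g.inChart x₀ (extChartAt (𝓡 4) x₀ p) u w =
      g.inner p (tangentCoordChange (𝓡 4) x₀ p p u) (tangentCoordChange (𝓡 4) x₀ p p w) := by
  rw [inChart, mfderiv_extChartAt_symm x₀ ((extChartAt (𝓡 4) x₀).map_source hp),
    (extChartAt (𝓡 4) x₀).left_inv hp]
  rfl

lemma inChart_tangentCoordChange (hp : p ∈ (extChartAt (𝓡 4) x₀).source) (u w : R4) :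
    g.inChart x₀ (extChartAt (𝓡 4) x₀ p) (tangentCoordChange (𝓡 4) p x₀ p u)
      (tangentCoordChange (𝓡 4) p x₀ p w) = g.inner p u w := by
  have hinv := tangentCoordChange_leftInverse (mem_extChartAt_source (I := 𝓡 4) p) hp
  rw [g.inChart_apply x₀ hp, hinv, hinv]

lemma inChart_symm (y u w : R4) : g.inChart x₀ y u w = g.inChart x₀ y w u :=
  g.symm _ _ _

lemma eq_zero_of_forall_inChart {y : R4} (hy : y ∈ (extChartAt (𝓡 4) x₀).target) (u : R4)
    (hu : ∀ w, g.inChart x₀ y u w = 0) : u = 0 := by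
  obtain ⟨p, hp, rfl⟩ : ∃ p ∈ (extChartAt (𝓡 4) x₀).source, extChartAt (𝓡 4) x₀ p = y :=
    ⟨_, (extChartAt (𝓡 4) x₀).map_target hy, (extChartAt (𝓡 4) x₀).right_inv hy⟩
  have hpp := mem_extChartAt_source (I := 𝓡 4) p
  have hzero : tangentCoordChange (𝓡 4) x₀ p p u = 0 := by
    refine g.eq_zero_of_forall_inner p _ fun (w : R4) ↦ ?_
    have hw := hu (tangentCoordChange (𝓡 4) p x₀ p w)
    rwa [g.inChart_apply x₀ hp, tangentCoordChange_leftInverse hpp hp] at hw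
  rw [← tangentCoordChange_leftInverse hp hpp u, hzero, map_zero]

lemma isInvertible_inChart {y : R4} (hy : y ∈ (extChartAt (𝓡 4) x₀).target) :
    (g.inChart x₀ y).IsInvertible := by
  have hinj : Function.Injective (g.inChart x₀ y : R4 →ₗ[ℝ] (R4 →L[ℝ] ℝ)) :=
    (injective_iff_map_eq_zero _).mpr fun u hu ↦
      g.eq_zero_of_forall_inChart x₀ hy u (DFunLike.congr_fun hu)
  have hfinrank : Module.finrank ℝ R4 = Module.finrank ℝ (R4 →L[ℝ] ℝ) := by
    rw [← (LinearMap.toContinuousLinearMap (𝕜 := ℝ) (E := R4) (F' := ℝ)).finrank_eq]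
    exact (Subspace.dual_finrank_eq (K := ℝ) (V := R4)).symm
  exact ⟨(LinearMap.linearEquivOfInjective _ hinj hfinrank).toContinuousLinearEquiv, by ext; rfl⟩

/-- The Christoffel symbols in the preferred chart around `x₀`, as a bilinear map. -/
def symbol (y : R4) : R4 →L[ℝ] R4 →L[ℝ] R4 :=
  (ContinuousLinearMap.compL ℝ R4 (R4 →L[ℝ] ℝ) R4 (g.inChart x₀ y).inverse) ∘L
    ((1 / 2 : ℝ) • (fderiv ℝ (g.inChart x₀) y + (fderiv ℝ (g.inChart x₀) y).flip
      - (ContinuousLinearMap.flipₗᵢ ℝ R4 R4 ℝ : (R4 →L[ℝ] R4 →L[ℝ] ℝ) →L[ℝ] R4 →L[ℝ] R4 →L[ℝ] ℝ) ∘L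
        (fderiv ℝ (g.inChart x₀) y).flip))

lemma symbol_apply (y u w : R4) : g.symbol x₀ y u w = g.christoffel x₀ y u w := by
  simp [symbol, christoffel]

lemma inChart_symbol {y : R4} (hy : y ∈ (extChartAt (𝓡 4) x₀).target) (u w t : R4) :
    g.inChart x₀ y (g.symbol x₀ y u w) t =
      1 / 2 * (fderiv ℝ (g.inChart x₀) y u w t + fderiv ℝ (g.inChart x₀) y w u t
        - fderiv ℝ (g.inChart x₀) y t u w) := by
  rw [symbol_apply, christoffel, (g.isInvertible_inChart x₀ hy).self_apply_inverse]
  simp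

lemma fderiv_inChart_symm {y : R4} (hy : y ∈ (extChartAt (𝓡 4) x₀).target) (u w t : R4) :
    fderiv ℝ (g.inChart x₀) y u w t = fderiv ℝ (g.inChart x₀) y u t w := by
  have hG : HasFDerivAt (g.inChart x₀) (fderiv ℝ (g.inChart x₀) y) y :=
    (((g.contDiffOn_inChart x₀).contDiffAt
      ((isOpen_extChartAt_target x₀).mem_nhds hy)).differentiableAt (by simp)).hasFDerivAt
  have hG_apply (w t : R4) : HasFDerivAt (fun y ↦ g.inChart x₀ y w t) _ y :=
    (hG.clm_apply (hasFDerivAt_const w y)).clm_apply (hasFDerivAt_const t y)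
  have hswap := hG_apply t w
  simp only [g.inChart_symm x₀ _ t w] at hswap
  simpa using DFunLike.congr_fun ((hG_apply w t).unique hswap) u

lemma contDiffOn_symbol : ContDiffOn ℝ ∞ (g.symbol x₀) (extChartAt (𝓡 4) x₀).target := by
  have hG := g.contDiffOn_inChart x₀
  have hG' : ContDiffOn ℝ ∞ (fderiv ℝ (g.inChart x₀)) (extChartAt (𝓡 4) x₀).target :=
    hG.fderiv_of_isOpen (isOpen_extChartAt_target x₀) (by simp)
  have hflip : ContDiffOn ℝ ∞ (fun y ↦ (fderiv ℝ (g.inChart x₀) y).flip)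
      (extChartAt (𝓡 4) x₀).target :=
    (ContinuousLinearMap.flipₗᵢ ℝ R4 R4
      (R4 →L[ℝ] ℝ)).toContinuousLinearEquiv.contDiff.comp_contDiffOn hG'
  have hinv : ContDiffOn ℝ ∞ (fun y ↦ (g.inChart x₀ y).inverse) (extChartAt (𝓡 4) x₀).target :=
    fun y hy ↦
      (g.isInvertible_inChart x₀ hy).contDiffAt_map_inverse.comp_contDiffWithinAt y (hG y hy)
  exact ((ContinuousLinearMap.compL ℝ R4 (R4 →L[ℝ] ℝ) R4).contDiff.comp_contDiffOn hinv).clm_comp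
    (((hG'.add hflip).sub (contDiffOn_const.clm_comp hflip)).const_smul (1 / 2 : ℝ))

lemma isLeviCivitaOn :
    IsLeviCivitaOn (g.inChart x₀) (g.symbol x₀) (extChartAt (𝓡 4) x₀).target where
  isOpen := isOpen_extChartAt_target x₀
  contDiffOn_metric := g.contDiffOn_inChart x₀
  contDiffOn_symbol := g.contDiffOn_symbol x₀
  metric_symm _ := g.inChart_symm x₀ _
  nondegenerate hy := g.eq_zero_of_forall_inChart x₀ hy
  symbol_symm {y} hy u w := by
    refine sub_eq_zero.mp (g.eq_zero_of_forall_inChart x₀ hy _ fun t ↦ ?_)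
    rw [map_sub, sub_apply, g.inChart_symbol x₀ hy, g.inChart_symbol x₀ hy,
      g.fderiv_inChart_symm x₀ hy t w u]
    ring
  compatible {y} hy u w t := by
    rw [g.inChart_symm x₀ y w, g.inChart_symbol x₀ hy, g.inChart_symbol x₀ hy,
      g.fderiv_inChart_symm x₀ hy u t w, g.fderiv_inChart_symm x₀ hy t u w,
      g.fderiv_inChart_symm x₀ hy w u t]
    ring

lemma riemann_eq (x : M) (u w t : R4) :
    g.riemann x u w t = localRiemann (g.symbol x) (extChartAt (𝓡 4) x x) u w t := by
  have hΓ := (g.isLeviCivitaOn x).hasFDerivAt_symbol (mem_extChartAt_target x)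
  have hfderiv (u w : R4) : fderiv ℝ (fun y ↦ g.christoffel x y w t) (extChartAt (𝓡 4) x x) u =
      fderiv ℝ (g.symbol x) (extChartAt (𝓡 4) x x) u w t := by
    simp only [← symbol_apply]
    rw [((hΓ.clm_apply (hasFDerivAt_const w _)).clm_apply (hasFDerivAt_const t _)).fderiv]
    simp
  simp only [riemann, localRiemann, hfderiv, symbol_apply]

lemma ricci_eq_trace (x : M) (u w : R4) (T : R4 →ₗ[ℝ] R4) (hT : ∀ z, T z = g.riemann x z u w) :
    g.ricci x u w = LinearMap.trace ℝ R4 T := by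
  rw [LinearMap.trace_eq_matrix_trace ℝ (EuclideanSpace.basisFun (Fin 4) ℝ).toBasis, ricci]
  simp [Matrix.trace, LinearMap.toMatrix_apply, hT]

lemma sum_localRiemann_eq (x : M) {e : Fin 2 → R4} {l m : R4}
    (h : IsNullFrame (g.inChart x (extChartAt (𝓡 4) x x)) e l m) :
    ∑ A, g.inChart x (extChartAt (𝓡 4) x x)
        (localRiemann (g.symbol x) (extChartAt (𝓡 4) x x) l (e A) m) (e A) =
      1 / 2 * g.inChart x (extChartAt (𝓡 4) x x) m
        (localRiemann (g.symbol x) (extChartAt (𝓡 4) x x) m l l) - g.ricci x l m := by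
  set z := extChartAt (𝓡 4) x x
  set R := localRiemann (g.symbol x) z with hR
  let T : R4 →ₗ[ℝ] R4 :=
    { toFun u := R u l m
      map_add' u w := by simp only [hR, localRiemann, map_add, add_apply]; abel
      map_smul' c u := by
        simp only [hR, localRiemann, map_smul, smul_apply, RingHom.id_apply]; module }
  have ricci_eq : g.ricci x l m =
      ∑ A, g.inChart x z (R (e A) l m) (e A) - 1 / 2 * g.inChart x z (R l l m) m
        - 1 / 2 * g.inChart x z (R m l m) l :=
    (g.ricci_eq_trace x l m T fun u ↦ (g.riemann_eq x u l m).symm).trans (h.trace_eq (by simp) T)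
  have anticomm (u w t : R4) : R u w t = -R w u t := by
    simp only [hR, localRiemann]
    abel
  have R_l_l : R l l m = 0 := by simp [hR, localRiemann]
  have pair_skew : g.inChart x z (R m l m) l = -g.inChart x z m (R m l l) :=
    ((g.isLeviCivitaOn x).metric_localRiemann_skew (mem_extChartAt_target x) m l m l).trans
      (congrArg Neg.neg (h.symm _ _))
  simp only [anticomm l (e _), map_neg, neg_apply, Finset.sum_neg_distrib]
  rw [ricci_eq, R_l_l, pair_skew, map_zero, zero_apply]
  ring

lemma fderiv_extChartAt_comp_symm (p : M) :
    fderiv ℝ (extChartAt (𝓡 4) x₁ ∘ (extChartAt (𝓡 4) x₀).symm) (extChartAt (𝓡 4) x₀ p) =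
      tangentCoordChange (𝓡 4) x₀ x₁ p := by
  rw [tangentCoordChange_def, ModelWithCorners.range_eq_univ, fderivWithin_univ]

lemma contDiffAt_extChartAt_comp_symm (hp₀ : p ∈ (extChartAt (𝓡 4) x₀).source)
    (hp₁ : p ∈ (extChartAt (𝓡 4) x₁).source) :
    ContDiffAt ℝ ∞ (extChartAt (𝓡 4) x₁ ∘ (extChartAt (𝓡 4) x₀).symm)
      (extChartAt (𝓡 4) x₀ p) := by
  have hchange := contDiffWithinAt_ext_coord_change (I := 𝓡 4) (n := ∞) x₁ x₀
    (y := extChartAt (𝓡 4) x₀ p) (by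
      rw [PartialEquiv.trans_source'', PartialEquiv.symm_symm, PartialEquiv.symm_target]
      exact Set.mem_image_of_mem _ ⟨hp₀, hp₁⟩)
  rwa [ModelWithCorners.range_eq_univ, contDiffWithinAt_univ] at hchange

lemma inChart_coordChange (hp₀ : p ∈ (extChartAt (𝓡 4) x₀).source)
    (hp₁ : p ∈ (extChartAt (𝓡 4) x₁).source) (u w : R4) :
    g.inChart x₀ (extChartAt (𝓡 4) x₀ p) u w =
      g.inChart x₁ (extChartAt (𝓡 4) x₁ p) (tangentCoordChange (𝓡 4) x₀ x₁ p u)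
        (tangentCoordChange (𝓡 4) x₀ x₁ p w) := by
  have hcomp (v : R4) := tangentCoordChange_comp (I := 𝓡 4) (v := v)
    ⟨⟨hp₀, hp₁⟩, mem_extChartAt_source (I := 𝓡 4) p⟩
  rw [g.inChart_apply x₀ hp₀, g.inChart_apply x₁ hp₁, hcomp, hcomp]

lemma eventually_inChart_coordChange (hp₀ : p ∈ (extChartAt (𝓡 4) x₀).source)
    (hp₁ : p ∈ (extChartAt (𝓡 4) x₁).source) :
    ∀ᶠ z in nhds (extChartAt (𝓡 4) x₀ p), ∀ u w, g.inChart x₀ z u w =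
      g.inChart x₁ ((extChartAt (𝓡 4) x₁ ∘ (extChartAt (𝓡 4) x₀).symm) z)
        (fderiv ℝ (extChartAt (𝓡 4) x₁ ∘ (extChartAt (𝓡 4) x₀).symm) z u)
        (fderiv ℝ (extChartAt (𝓡 4) x₁ ∘ (extChartAt (𝓡 4) x₀).symm) z w) := by
  have hsource : (extChartAt (𝓡 4) x₁).source ∈
      nhds ((extChartAt (𝓡 4) x₀).symm (extChartAt (𝓡 4) x₀ p)) := by
    rw [(extChartAt (𝓡 4) x₀).left_inv hp₀]
    exact extChartAt_source_mem_nhds' hp₁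
  filter_upwards [(isOpen_extChartAt_target x₀).mem_nhds ((extChartAt (𝓡 4) x₀).map_source hp₀),
    continuousAt_extChartAt_symm' hp₀ hsource] with z hz hz₁ u w
  have hp' := (extChartAt (𝓡 4) x₀).map_target hz
  have hchange := g.inChart_coordChange x₀ x₁ hp' hz₁ u w
  rwa [← fderiv_extChartAt_comp_symm, (extChartAt (𝓡 4) x₀).right_inv hz] at hchange

lemma symbol_tangentCoordChange (hp₀ : p ∈ (extChartAt (𝓡 4) x₀).source)
    (hp₁ : p ∈ (extChartAt (𝓡 4) x₁).source) (u w : R4) :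
    g.symbol x₁ (extChartAt (𝓡 4) x₁ p) (tangentCoordChange (𝓡 4) x₀ x₁ p u)
        (tangentCoordChange (𝓡 4) x₀ x₁ p w)
      + fderiv ℝ (fderiv ℝ (extChartAt (𝓡 4) x₁ ∘ (extChartAt (𝓡 4) x₀).symm))
          (extChartAt (𝓡 4) x₀ p) u w =
      tangentCoordChange (𝓡 4) x₀ x₁ p (g.symbol x₀ (extChartAt (𝓡 4) x₀ p) u w) := by
  have hcoord : (extChartAt (𝓡 4) x₁ ∘ (extChartAt (𝓡 4) x₀).symm) (extChartAt (𝓡 4) x₀ p) =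
      extChartAt (𝓡 4) x₁ p := by
    rw [Function.comp, (extChartAt (𝓡 4) x₀).left_inv hp₀]
  have hdefect := (g.isLeviCivitaOn x₀).symbolDefect_eq_zero (g.isLeviCivitaOn x₁)
    ((extChartAt (𝓡 4) x₀).map_source hp₀) (hcoord ▸ (extChartAt (𝓡 4) x₁).map_source hp₁)
    (contDiffAt_extChartAt_comp_symm x₀ x₁ hp₀ hp₁)
    (by
      rw [fderiv_extChartAt_comp_symm]
      exact (tangentCoordChange_leftInverse hp₁ hp₀).surjective)
    (g.eventually_inChart_coordChange x₀ x₁ hp₀ hp₁) u w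
  rwa [symbolDefect, sub_eq_zero, hcoord, fderiv_extChartAt_comp_symm] at hdefect

end LorentzMetric

section Along

variable {M : Type*} [TopologicalSpace M] [ChartedSpace R4 M] [IsManifold (𝓡 4) ∞ M]
  (g : LorentzMetric M) {E : Type*} [NormedAddCommGroup E] [NormedSpace ℝ E] {K : Type*}
  [TopologicalSpace K] {I : ModelWithCorners ℝ E K} {H : Type*} [TopologicalSpace H]
  [ChartedSpace K H]

/-- Near `q`, the map `ι : H → M` is `f : U → ℝ⁴` in the preferred charts around `q₀` and `x₀`. -/
structure IsCoordRepAt (I : ModelWithCorners ℝ E K) (ι : H → M) (q₀ : H) (x₀ : M) (U : Set E)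
    (f : E → R4) (q : H) : Prop where
  isChartDomain : IsChartDomain I q₀ U
  mem_source : q ∈ (extChartAt I q₀).source
  extChartAt_mem : extChartAt I q₀ q ∈ U
  map_mem_source : ι q ∈ (extChartAt (𝓡 4) x₀).source
  mdifferentiableAt : MDifferentiableAt I (𝓡 4) ι q
  differentiableWithinAt : DifferentiableWithinAt ℝ f U (extChartAt I q₀ q)
  eventually_eq : ∀ᶠ q' in nhds q, extChartAt (𝓡 4) x₀ (ι q') = f (extChartAt I q₀ q')

variable {q₀ q : H} {U : Set E} {ι : H → M} {x₀ : M} {f : E → R4}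

section LinearInDirection

variable (ι) (Y : (q : H) → TangentSpace (𝓡 4) (ι q)) (q)

lemma LorentzMetric.exists_covAlong_eq : ∃ T : E →L[ℝ] R4, ∀ X : TangentSpace I q,
    g.covAlong I ι Y q X = T X := by
  let dY : E →L[ℝ] R4 := mfderiv I 𝓘(ℝ, R4) (fun q' ↦
    (trivializationAt R4 (TangentSpace (𝓡 4) : M → Type _) (ι q)
      (⟨ι q', Y q'⟩ : TangentBundle (𝓡 4) M)).2) q
  let dι : E →L[ℝ] R4 := mfderiv I (𝓡 4) ι q
  refine ⟨dY + (g.symbol (ι q) (extChartAt (𝓡 4) (ι q) (ι q))).flip (Y q) ∘L dι, fun X ↦ ?_⟩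
  exact congrArg (fun w : R4 ↦ dY X + w) (g.symbol_apply _ _ _ _).symm

end LinearInDirection

namespace IsCoordRepAt

variable {Y : (q : H) → TangentSpace (𝓡 4) (ι q)} {Y' : E → R4}

lemma eventually_trivializationAt_snd (h : IsCoordRepAt I ι q₀ x₀ U f q)
    (hY : ∀ᶠ q' in nhds q,
      tangentCoordChange (𝓡 4) (ι q') x₀ (ι q') (Y q') = Y' (extChartAt I q₀ q')) :
    ∀ᶠ q' in nhds q, (trivializationAt R4 (TangentSpace (𝓡 4) : M → Type _) (ι q)
        (⟨ι q', Y q'⟩ : TangentBundle (𝓡 4) M)).2 =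
      fderiv ℝ (extChartAt (𝓡 4) (ι q) ∘ (extChartAt (𝓡 4) x₀).symm) (f (extChartAt I q₀ q'))
        (Y' (extChartAt I q₀ q')) := by
  have hι := h.mdifferentiableAt.continuousAt
  filter_upwards [h.eventually_eq, hY, hι (extChartAt_source_mem_nhds' h.map_mem_source),
    hι (extChartAt_source_mem_nhds (I := 𝓡 4) (ι q))] with q' hf hYq' hx₀ hιq
  rw [← hf, ← hYq', LorentzMetric.fderiv_extChartAt_comp_symm]
  exact (tangentCoordChange_comp (I := 𝓡 4) (v := (Y q' : R4))
    ⟨⟨mem_extChartAt_source (I := 𝓡 4) (ι q'), hx₀⟩, hιq⟩).symm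

variable [IsManifold I 1 H]

lemma tangentCoordChange_mfderiv (h : IsCoordRepAt I ι q₀ x₀ U f q) (X : TangentSpace I q) :
    tangentCoordChange (𝓡 4) (ι q) x₀ (ι q) (mfderiv I (𝓡 4) ι q X) =
      fderivWithin ℝ f U (extChartAt I q₀ q) (tangentCoordChange I q q₀ q X) := by
  have hιq : ι q ∈ (chartAt R4 x₀).source := by
    rw [← extChartAt_source (𝓡 4)]
    exact h.map_mem_source
  have hchart : HasMFDerivAt (𝓡 4) 𝓘(ℝ, R4) (extChartAt (𝓡 4) x₀) (ι q) _ :=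
    (mdifferentiableAt_extChartAt hιq).hasMFDerivAt
  rw [mfderiv_extChartAt_eq_tangentCoordChange h.map_mem_source] at hchart
  exact congrArg (fun l : E →L[ℝ] R4 ↦ l X) (hasMFDerivAt_unique
    (hchart.comp q h.mdifferentiableAt.hasMFDerivAt)
    (h.isChartDomain.hasMFDerivAt h.mem_source h.extChartAt_mem h.differentiableWithinAt
      h.eventually_eq))

lemma mfderiv_trivializationAt_snd (h : IsCoordRepAt I ι q₀ x₀ U f q)
    (hY' : DifferentiableWithinAt ℝ Y' U (extChartAt I q₀ q))
    (hY : ∀ᶠ q' in nhds q,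
      tangentCoordChange (𝓡 4) (ι q') x₀ (ι q') (Y q') = Y' (extChartAt I q₀ q'))
    (X : TangentSpace I q) :
    (mfderiv I 𝓘(ℝ, R4) (fun q' ↦ (trivializationAt R4 (TangentSpace (𝓡 4) : M → Type _) (ι q)
        (⟨ι q', Y q'⟩ : TangentBundle (𝓡 4) M)).2) q X : R4) =
      tangentCoordChange (𝓡 4) x₀ (ι q) (ι q)
          (fderivWithin ℝ Y' U (extChartAt I q₀ q) (tangentCoordChange I q q₀ q X))
        + fderiv ℝ (fderiv ℝ (extChartAt (𝓡 4) (ι q) ∘ (extChartAt (𝓡 4) x₀).symm))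
          (f (extChartAt I q₀ q))
          (fderivWithin ℝ f U (extChartAt I q₀ q) (tangentCoordChange I q q₀ q X))
          (Y' (extChartAt I q₀ q)) := by
  have hfq : f (extChartAt I q₀ q) = extChartAt (𝓡 4) x₀ (ι q) := h.eventually_eq.self_of_nhds.symm
  have hchange := LorentzMetric.contDiffAt_extChartAt_comp_symm x₀ (ι q) h.map_mem_source
    (mem_extChartAt_source (ι q))
  rw [← hfq] at hchange
  have hchange₂ :=
    ((hchange.fderiv_right (m := ∞) (by simp)).differentiableAt (by simp)).hasFDerivAt
  have hrep := (hchange₂.comp_hasFDerivWithinAt _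
    h.differentiableWithinAt.hasFDerivWithinAt).clm_apply hY'.hasFDerivWithinAt
  rw [(h.isChartDomain.hasMFDerivAt h.mem_source h.extChartAt_mem hrep.differentiableWithinAt
    (h.eventually_trivializationAt_snd hY)).mfderiv,
    ← LorentzMetric.fderiv_extChartAt_comp_symm, ← hfq]
  exact congrArg (fun l : E →L[ℝ] R4 ↦ l (tangentCoordChange I q q₀ q X))
    (hrep.fderivWithin (h.isChartDomain.uniqueDiffOn _ h.extChartAt_mem))

/-- Both sides involve second derivatives of the change of coordinates; they cancel by the
transformation law of the Christoffel symbols. -/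
lemma tangentCoordChange_covAlong (h : IsCoordRepAt I ι q₀ x₀ U f q)
    (hY' : DifferentiableWithinAt ℝ Y' U (extChartAt I q₀ q))
    (hY : ∀ᶠ q' in nhds q,
      tangentCoordChange (𝓡 4) (ι q') x₀ (ι q') (Y q') = Y' (extChartAt I q₀ q'))
    (X : TangentSpace I q) :
    tangentCoordChange (𝓡 4) (ι q) x₀ (ι q) (g.covAlong I ι Y q X) =
      localCov (g.symbol x₀) f U Y' (extChartAt I q₀ q) (tangentCoordChange I q q₀ q X) := by
  have hιq := mem_extChartAt_source (I := 𝓡 4) (ι q)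
  have hback := tangentCoordChange_leftInverse hιq h.map_mem_source
  have hforth := tangentCoordChange_leftInverse h.map_mem_source hιq
  let X' : E := tangentCoordChange I q q₀ q X
  let dι : R4 := mfderiv I (𝓡 4) ι q X
  let Yq : R4 := Y q
  have hdι : tangentCoordChange (𝓡 4) (ι q) x₀ (ι q) dι =
    fderivWithin ℝ f U (extChartAt I q₀ q) X' := h.tangentCoordChange_mfderiv X
  have hYq : tangentCoordChange (𝓡 4) (ι q) x₀ (ι q) Yq = Y' (extChartAt I q₀ q) :=
    hY.self_of_nhds
  have hfq : extChartAt (𝓡 4) x₀ (ι q) = f (extChartAt I q₀ q) := h.eventually_eq.self_of_nhds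
  have hsymbol := g.symbol_tangentCoordChange x₀ (ι q) h.map_mem_source hιq
    (fderivWithin ℝ f U (extChartAt I q₀ q) X') (Y' (extChartAt I q₀ q))
  rw [← hdι, hback, ← hYq, hback, hdι, hYq, hfq, g.symbol_apply] at hsymbol
  have hcov : (g.covAlong I ι Y q X : R4) = tangentCoordChange (𝓡 4) x₀ (ι q) (ι q)
      (localCov (g.symbol x₀) f U Y' (extChartAt I q₀ q) X') := by
    rw [localCov_apply, map_add, ← hsymbol, ← add_assoc, add_right_comm,
      ← h.mfderiv_trivializationAt_snd hY' hY X]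
    rfl
  exact (congrArg _ hcov).trans (hforth _)

end IsCoordRepAt

end Along

section Frames

variable {E : Type*} [NormedAddCommGroup E] [NormedSpace ℝ E]

/-- The vector `x` rescaled to unit length for the bilinear form `B`; it is the unit vector in the
direction of `x` only where `B x x` is positive. -/
def bilinNormalize (B : E →L[ℝ] E →L[ℝ] ℝ) (x : E) : E := (√(B x x))⁻¹ • x

/-- The component of `w` orthogonal to `x` for the bilinear form `B`, multiplied by `B x x` in order
to avoid a division. -/
def gramSchmidtRemainder (B : E →L[ℝ] E →L[ℝ] ℝ) (x w : E) : E := B x x • w - B x w • x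

/-- The Gram–Schmidt orthonormalisation of the pair `(x, w)` for the bilinear form `B`. -/
def gramSchmidtPair (B : E →L[ℝ] E →L[ℝ] ℝ) (x w : E) : Fin 2 → E :=
  ![bilinNormalize B x, bilinNormalize B (gramSchmidtRemainder B x w)]

lemma bilin_bilinNormalize_self {B : E →L[ℝ] E →L[ℝ] ℝ} {x : E} (hx : 0 < B x x) :
    B (bilinNormalize B x) (bilinNormalize B x) = 1 := by
  have hsqrt : √(B x x) ≠ 0 := (Real.sqrt_pos.mpr hx).ne'
  simp only [bilinNormalize, map_smul, smul_apply, smul_eq_mul]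
  field_simp
  exact (Real.sq_sqrt hx.le).symm

lemma bilinNormalize_of_eq_one {B : E →L[ℝ] E →L[ℝ] ℝ} {x : E} (hx : B x x = 1) :
    bilinNormalize B x = x := by
  simp [bilinNormalize, hx]

lemma bilin_gramSchmidtRemainder (B : E →L[ℝ] E →L[ℝ] ℝ) (x w : E) :
    B x (gramSchmidtRemainder B x w) = 0 := by
  simp only [gramSchmidtRemainder, map_sub, map_smul, smul_eq_mul]
  ring

lemma gramSchmidtRemainder_of_orthonormal {B : E →L[ℝ] E →L[ℝ] ℝ} {x w : E} (hx : B x x = 1)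
    (hxw : B x w = 0) : gramSchmidtRemainder B x w = w := by
  simp [gramSchmidtRemainder, hx, hxw]

lemma gramSchmidtPair_orthonormal {B : E →L[ℝ] E →L[ℝ] ℝ} (hsymm : ∀ u w, B u w = B w u)
    {x w : E} (hx : 0 < B x x)
    (hw : 0 < B (gramSchmidtRemainder B x w) (gramSchmidtRemainder B x w)) (A A' : Fin 2) :
    B (gramSchmidtPair B x w A) (gramSchmidtPair B x w A') = if A = A' then 1 else 0 := by
  have horth : B (bilinNormalize B x) (bilinNormalize B (gramSchmidtRemainder B x w)) = 0 := by
    simp [bilinNormalize, bilin_gramSchmidtRemainder]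
  have horth' : B (bilinNormalize B (gramSchmidtRemainder B x w)) (bilinNormalize B x) = 0 := by
    rw [hsymm, horth]
  fin_cases A <;> fin_cases A' <;>
    simp [gramSchmidtPair, bilin_bilinNormalize_self, hx, hw, horth, horth']

lemma gramSchmidtPair_of_orthonormal {B : E →L[ℝ] E →L[ℝ] ℝ} {a : Fin 2 → E}
    (ha : ∀ A A', B (a A) (a A') = if A = A' then 1 else 0) :
    gramSchmidtPair B (a 0) (a 1) = a := by
  funext A
  fin_cases A <;>
    simp [gramSchmidtPair, gramSchmidtRemainder_of_orthonormal, bilinNormalize_of_eq_one, ha]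

lemma map_gramSchmidtPair {B : E →L[ℝ] E →L[ℝ] ℝ} {η : E →L[ℝ] ℝ} {x w : E} (hx : η x = 0)
    (hw : η w = 0) (A : Fin 2) : η (gramSchmidtPair B x w A) = 0 := by
  fin_cases A <;> simp [gramSchmidtPair, bilinNormalize, gramSchmidtRemainder, hx, hw]

section Smooth

variable {E' : Type*} [NormedAddCommGroup E'] [NormedSpace ℝ E'] {U : Set E'} {n : WithTop ℕ∞}
  {B : E' → E →L[ℝ] E →L[ℝ] ℝ} {x w : E' → E}

lemma contDiffOn_bilinNormalize (hB : ContDiffOn ℝ n B U) (hx : ContDiffOn ℝ n x U)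
    (hpos : ∀ y ∈ U, 0 < B y (x y) (x y)) :
    ContDiffOn ℝ n (fun y ↦ bilinNormalize (B y) (x y)) U :=
  ((((hB.clm_apply hx).clm_apply hx).sqrt fun y hy ↦ (hpos y hy).ne').inv
    fun y hy ↦ (Real.sqrt_pos.mpr (hpos y hy)).ne').smul hx

lemma contDiffOn_gramSchmidtRemainder (hB : ContDiffOn ℝ n B U) (hx : ContDiffOn ℝ n x U)
    (hw : ContDiffOn ℝ n w U) :
    ContDiffOn ℝ n (fun y ↦ gramSchmidtRemainder (B y) (x y) (w y)) U :=
  (((hB.clm_apply hx).clm_apply hx).smul hw).sub (((hB.clm_apply hx).clm_apply hw).smul hx)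

lemma contDiffOn_gramSchmidtPair (hB : ContDiffOn ℝ n B U) (hx : ContDiffOn ℝ n x U)
    (hw : ContDiffOn ℝ n w U) (hxpos : ∀ y ∈ U, 0 < B y (x y) (x y))
    (hwpos : ∀ y ∈ U, 0 < B y (gramSchmidtRemainder (B y) (x y) (w y))
      (gramSchmidtRemainder (B y) (x y) (w y))) (A : Fin 2) :
    ContDiffOn ℝ n (fun y ↦ gramSchmidtPair (B y) (x y) (w y) A) U := by
  fin_cases A
  · exact contDiffOn_bilinNormalize hB hx hxpos
  · exact contDiffOn_bilinNormalize hB (contDiffOn_gramSchmidtRemainder hB hx hw) hwpos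

end Smooth

lemma exists_orthonormal_frame {E' : Type*} [NormedAddCommGroup E'] [NormedSpace ℝ E']
    {U : Set E'} {n : WithTop ℕ∞} {y₀ : E'} (hy₀ : y₀ ∈ U) {B : E' → E →L[ℝ] E →L[ℝ] ℝ}
    {η : E' → E →L[ℝ] ℝ} {L : E' → E} (hB : ContDiffOn ℝ n B U) (hη : ContDiffOn ℝ n η U)
    (hL : ContDiffOn ℝ n L U) (hsymm : ∀ y ∈ U, ∀ u w, B y u w = B y w u)
    (hηL : ∀ y ∈ U, η y (L y) ≠ 0) (a : Fin 2 → E) (hηa : ∀ A, η y₀ (a A) = 0)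
    (hBa : ∀ A A', B y₀ (a A) (a A') = if A = A' then 1 else 0) :
    ∃ (V : Set E') (e : Fin 2 → E' → E), IsOpen V ∧ y₀ ∈ V ∧
      (∀ A, ContDiffOn ℝ n (e A) (U ∩ V)) ∧ (∀ A, e A y₀ = a A) ∧
      ∀ y ∈ U ∩ V, (∀ A, η y (e A y) = 0) ∧
        ∀ A A', B y (e A y) (e A' y) = if A = A' then 1 else 0 := by
  -- project the constant extensions of the `a A` along `L` into the kernel of `η`
  let X : Fin 2 → E' → E := fun A y ↦ a A - (η y (a A) / η y (L y)) • L y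
  have hX : ∀ A, ContDiffOn ℝ n (X A) U := fun A ↦ contDiffOn_const.sub
    (((hη.clm_apply contDiffOn_const).div (hη.clm_apply hL) hηL).smul hL)
  have hηX : ∀ y ∈ U, ∀ A, η y (X A y) = 0 := fun y hy A ↦ by simp [X, hηL y hy]
  have hX₀ : ∀ A, X A y₀ = a A := fun A ↦ by simp [X, hηa]
  let Z : E' → E := fun y ↦ gramSchmidtRemainder (B y) (X 0 y) (X 1 y)
  have hZ : ContDiffOn ℝ n Z U := contDiffOn_gramSchmidtRemainder hB (hX 0) (hX 1)
  have hZ₀ : Z y₀ = a 1 := by simp [Z, hX₀, gramSchmidtRemainder_of_orthonormal, hBa]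
  have hnear (Y : E' → E) (hY : ContDiffOn ℝ n Y U) (hY₀ : B y₀ (Y y₀) (Y y₀) = 1) :
      ∀ᶠ y in nhdsWithin y₀ U, 0 < B y (Y y) (Y y) :=
    (((hB.clm_apply hY).clm_apply hY).continuousOn y₀ hy₀).eventually
      (lt_mem_nhds (by simp [hY₀]))
  obtain ⟨V, hV, hyV, hVU⟩ := mem_nhdsWithin.mp <|
    (hnear (X 0) (hX 0) (by simp [hX₀, hBa])).and (hnear Z hZ (by simp [hZ₀, hBa]))
  have hpos : ∀ y ∈ U ∩ V, 0 < B y (X 0 y) (X 0 y) ∧ 0 < B y (Z y) (Z y) :=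
    fun y hy ↦ hVU ⟨hy.2, hy.1⟩
  have hUV : U ∩ V ⊆ U := Set.inter_subset_left
  refine ⟨V, fun A y ↦ gramSchmidtPair (B y) (X 0 y) (X 1 y) A, hV, hyV,
    contDiffOn_gramSchmidtPair (hB.mono hUV) ((hX 0).mono hUV) ((hX 1).mono hUV)
      (fun y hy ↦ (hpos y hy).1) (fun y hy ↦ (hpos y hy).2), fun A ↦ ?_, fun y hy ↦
    ⟨map_gramSchmidtPair (hηX y hy.1 0) (hηX y hy.1 1),
      gramSchmidtPair_orthonormal (hsymm y hy.1) (hpos y hy).1 (hpos y hy).2⟩⟩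
  simp only [hX₀, gramSchmidtPair_of_orthonormal hBa]

lemma exists_orthonormal_of_pos_on_ker (hE : Module.finrank ℝ E = 3) (B : E →L[ℝ] E →L[ℝ] ℝ)
    (η : E →L[ℝ] ℝ) (hη : η ≠ 0) (hsymm : ∀ u w, B u w = B w u)
    (hpos : ∀ u, η u = 0 → u ≠ 0 → 0 < B u u) :
    ∃ a : Fin 2 → E, (∀ A, η (a A) = 0) ∧
      ∀ A A', B (a A) (a A') = if A = A' then 1 else 0 := by
  have : FiniteDimensional ℝ E := .of_finrank_pos (by omega)
  have hker : Module.finrank ℝ η.ker = 2 := by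
    have hrank := (η : E →ₗ[ℝ] ℝ).finrank_range_add_finrank_ker
    rw [LinearMap.range_eq_top.mpr
      (LinearMap.surjective (ContinuousLinearMap.coe_injective.ne hη)), finrank_top, hE,
      Module.finrank_self] at hrank
    exact (by omega : Module.finrank ℝ (η : E →ₗ[ℝ] ℝ).ker = 2)
  let c := Module.finBasisOfFinrankEq ℝ η.ker hker
  have hli : LinearIndependent ℝ (fun A ↦ (c A : E)) :=
    c.linearIndependent.map' η.ker.subtype (Submodule.ker_subtype _)
  have hηc (A : Fin 2) : η (c A) = 0 := (c A).2
  have hx : 0 < B (c 0) (c 0) := hpos _ (hηc 0) (hli.ne_zero 0)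
  have hz : gramSchmidtRemainder B (c 0 : E) (c 1) ≠ 0 := fun h ↦ hx.ne' <|
    Fintype.linearIndependent_iff.mp hli ![-B (c 0) (c 1), B (c 0) (c 0)] (by
      rw [← h, Fin.sum_univ_two, gramSchmidtRemainder]
      simp only [Matrix.cons_val_zero, Matrix.cons_val_one]
      module) 1
  have hηz : η (gramSchmidtRemainder B (c 0 : E) (c 1)) = 0 := by
    simp [gramSchmidtRemainder, hηc]
  exact ⟨gramSchmidtPair B (c 0 : E) (c 1), map_gramSchmidtPair (hηc 0) (hηc 1),
    gramSchmidtPair_orthonormal hsymm hx (hpos _ hηz hz)⟩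

end Frames

lemma sum_contraction_eq {κ V E : Type*} [Fintype κ] [AddCommGroup V] [Module ℝ V]
    [AddCommGroup E] [Module ℝ E] {s : E → E → ℝ} (hs : ∀ u w, s u w = s w u) {e e' : κ → E}
    (he : ∀ A, e A = ∑ B, s (e A) (e' B) • e' B) (he' : ∀ A, e' A = ∑ B, s (e' A) (e B) • e B)
    (T : E →ₗ[ℝ] E →ₗ[ℝ] V) :
    ∑ A, T (e A) (e A) = ∑ A, T (e' A) (e' A) := by
  calc ∑ A, T (e A) (e A) = ∑ A, ∑ B, s (e A) (e' B) • T (e' B) (e A) := by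
        refine Finset.sum_congr rfl fun A _ ↦ ?_
        conv_lhs => enter [1]; rw [he A]
        simp
    _ = ∑ B, ∑ A, s (e A) (e' B) • T (e' B) (e A) := Finset.sum_comm
    _ = ∑ B, T (e' B) (e' B) := by
        refine Finset.sum_congr rfl fun B _ ↦ ?_
        conv_rhs => enter [2]; rw [he' B]
        simp [hs (e' B)]

lemma minkowski_pos_of_orthogonal {n : ℕ} {t u : Fin (n + 1) → ℝ}
    (ht : ∑ i : Fin n, t i.succ ^ 2 < t 0 ^ 2)
    (hut : ∑ i : Fin n, u i.succ * t i.succ = u 0 * t 0) (hu : u ≠ 0) :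
    u 0 ^ 2 < ∑ i : Fin n, u i.succ ^ 2 := by
  have hcs : (u 0 * t 0) ^ 2 ≤ (∑ i : Fin n, u i.succ ^ 2) * ∑ i : Fin n, t i.succ ^ 2 :=
    hut ▸ Finset.sum_mul_sq_le_sq_mul_sq _ _ _
  have ht₀ : 0 ≤ ∑ i : Fin n, t i.succ ^ 2 := Finset.sum_nonneg fun i _ ↦ sq_nonneg _
  by_contra! hle
  have hu₀ : u 0 ^ 2 = 0 := by
    by_contra h
    have : 0 < u 0 ^ 2 := (sq_nonneg _).lt_of_ne' h
    nlinarith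
  have hsum : ∑ i : Fin n, u i.succ ^ 2 = 0 :=
    le_antisymm (hle.trans_eq hu₀) (Finset.sum_nonneg fun i _ ↦ sq_nonneg _)
  refine hu (funext (Fin.cases (by simpa using hu₀) fun i ↦ ?_))
  simpa using (Finset.sum_eq_zero_iff_of_nonneg fun i _ ↦ sq_nonneg (u i.succ)).mp hsum i
    (Finset.mem_univ i)

namespace LorentzMetric

variable {M : Type*} [TopologicalSpace M] [ChartedSpace R4 M] [IsManifold (𝓡 4) ∞ M]
  (g : LorentzMetric M)

lemma inner_pos_of_orthogonal {x : M} {t u : TangentSpace (𝓡 4) x} (ht : g.inner x t t < 0)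
    (hut : g.inner x u t = 0) (hu : u ≠ 0) : 0 < g.inner x u u := by
  obtain ⟨b, hb⟩ := g.signature x
  have hinner (u w : TangentSpace (𝓡 4) x) : g.inner x u w =
      ∑ i : Fin 3, b.repr u i.succ * b.repr w i.succ - b.repr u 0 * b.repr w 0 := by
    conv_lhs => rw [← b.sum_repr u, ← b.sum_repr w]
    simp only [map_sum, map_smul, sum_apply, smul_apply, hb]
    simp [Fin.sum_univ_succ, mul_comm, neg_add_eq_sub]
  simp only [hinner, ← sq, sub_neg, sub_eq_zero, sub_pos] at ht hut ⊢
  exact minkowski_pos_of_orthogonal ht hut fun h ↦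
    hu (b.repr.map_eq_zero_iff.mp (DFunLike.coe_injective h))

end LorentzMetric

namespace NullFoliation

variable {M : Type*} [TopologicalSpace M] [ChartedSpace R4 M] [IsManifold (𝓡 4) ∞ M]
  {g : LorentzMetric M}
  {K : Type*} [TopologicalSpace K] {I : ModelWithCorners ℝ (EuclideanSpace ℝ (Fin 3)) K}
  {H : Type*} [TopologicalSpace H] [ChartedSpace K H] [IsManifold I ∞ H]
  (F : NullFoliation g I H)

section Linearity

variable (q : H) (c : ℝ) (X X' : TangentSpace I q) (Y : (q : H) → TangentSpace (𝓡 4) (F.ι q))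

lemma push_add : F.push q (X + X') = F.push q X + F.push q X' := map_add _ _ _

lemma push_smul : F.push q (c • X) = c • F.push q X := map_smul _ _ _

lemma D_add_right : F.D Y q (X + X') = F.D Y q X + F.D Y q X' := by
  obtain ⟨T, hT⟩ := g.exists_covAlong_eq (I := I) q F.ι Y
  simp only [D, hT]
  exact map_add T X X'

lemma D_smul_right : F.D Y q (c • X) = c • F.D Y q X := by
  obtain ⟨T, hT⟩ := g.exists_covAlong_eq (I := I) q F.ι Y
  simp only [D, hT]
  exact map_smul T c X

end Linearity

/-- The form `F.slash q` as a continuous bilinear form on the model space of `H`. -/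
def slashBilin (q : H) :
    EuclideanSpace ℝ (Fin 3) →L[ℝ] EuclideanSpace ℝ (Fin 3) →L[ℝ] ℝ :=
  let dι : EuclideanSpace ℝ (Fin 3) →L[ℝ] R4 := mfderiv I (𝓡 4) F.ι q
  let G : R4 →L[ℝ] R4 →L[ℝ] ℝ := g.inner (F.ι q)
  G.bilinearComp dι dι

/-- The form `χ̲` as a bilinear form. -/
def chibarBilin (q : H) : TangentSpace I q →ₗ[ℝ] TangentSpace I q →ₗ[ℝ] ℝ :=
  LinearMap.mk₂ ℝ (F.chibar q)
    (fun X X' Y ↦ by simp [chibar, D_add_right]) (fun c X Y ↦ by simp [chibar, D_smul_right])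
    (fun X Y Y' ↦ by simp [chibar, push_add]) (fun c X Y ↦ by simp [chibar, push_smul])

/-- The form `ζ` as a linear form. -/
def zetaLin (q : H) : TangentSpace I q →ₗ[ℝ] ℝ where
  toFun := F.zeta q
  map_add' X X' := by simp [zeta, D_add_right, mul_add]
  map_smul' c X := by simp [zeta, D_smul_right, mul_left_comm]

lemma slash_symm (q : H) (X Y : TangentSpace I q) : F.slash q X Y = F.slash q Y X :=
  g.symm _ _ _

lemma inner_push_L_add_Lbar (q : H) :
    g.inner (F.ι q) (F.push q (F.L q) + F.Lbar q) (F.push q (F.L q) + F.Lbar q) = -4 := by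
  have hLL : g.inner (F.ι q) (F.push q (F.L q)) (F.push q (F.L q)) = 0 := F.L_orthogonal q _
  have hLLbar : g.inner (F.ι q) (F.push q (F.L q)) (F.Lbar q) = -2 := F.inner_L_Lbar q
  have hLbarL : g.inner (F.ι q) (F.Lbar q) (F.push q (F.L q)) = -2 := (g.symm _ _ _).trans hLLbar
  simp only [map_add, add_apply, hLL, hLLbar, hLbarL, F.Lbar_null]
  norm_num

lemma slash_pos (q : H) {X : TangentSpace I q} (hX : dirDeriv I F.v q X = 0) (hX₀ : X ≠ 0) :
    0 < F.slash q X X := by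
  have hpush : F.push q X ≠ 0 := fun h ↦ hX₀ (F.immersion_ι q (h.trans (map_zero _).symm))
  refine g.inner_pos_of_orthogonal (t := F.push q (F.L q) + F.Lbar q)
    ((F.inner_push_L_add_Lbar q).trans_lt (by norm_num)) ?_ hpush
  have hXL : g.inner (F.ι q) (F.push q X) (F.push q (F.L q)) = 0 :=
    (g.symm _ _ _).trans (F.L_orthogonal q X)
  have hXLbar : g.inner (F.ι q) (F.push q X) (F.Lbar q) = 0 :=
    (g.symm _ _ _).trans (F.Lbar_orthogonal q X hX)
  rw [map_add, hXL, hXLbar, add_zero]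

lemma exists_isFrame (q : H) : ∃ e, F.IsFrame q e := by
  let dv : EuclideanSpace ℝ (Fin 3) →L[ℝ] ℝ := mfderiv I 𝓘(ℝ, ℝ) F.v q
  refine exists_orthonormal_of_pos_on_ker (by simp) (F.slashBilin q) dv (fun h ↦ ?_)
    (F.slash_symm q) fun X ↦ F.slash_pos q
  exact (F.lapse_pos q).ne' (congrArg (fun l : EuclideanSpace ℝ (Fin 3) →L[ℝ] ℝ ↦ l (F.L q)) h)

lemma isFrame_e (q : H) : F.IsFrame q (F.e q) := Classical.epsilon_spec (F.exists_isFrame q)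

variable {F}

namespace IsFrame

variable {q : H} {e : Fin 2 → TangentSpace I q}

lemma isNullFrame (he : F.IsFrame q e) :
    IsNullFrame (F := R4) (g.inner (F.ι q)) (fun A ↦ F.push q (e A)) (F.push q (F.L q))
      (F.Lbar q) where
  symm := g.symm _
  nondegenerate := g.eq_zero_of_forall_inner _
  e_e := he.2
  e_l A := (g.symm _ _ _).trans (F.L_orthogonal q (e A))
  e_m A := (g.symm _ _ _).trans (F.Lbar_orthogonal q (e A) (he.1 A))
  l_l := F.L_orthogonal q _
  m_m := F.Lbar_null q
  l_m := F.inner_L_Lbar q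

lemma expansion (he : F.IsFrame q e) {X : TangentSpace I q} (hX : dirDeriv I F.v q X = 0) :
    X = ∑ B, F.slash q X (e B) • e B := by
  have hXLbar : g.inner (F.ι q) (F.push q X) (F.Lbar q) = 0 :=
    (g.symm _ _ _).trans (F.Lbar_orthogonal q X hX)
  have hXL : g.inner (F.ι q) (F.push q X) (F.push q (F.L q)) = 0 :=
    (g.symm _ _ _).trans (F.L_orthogonal q X)
  have hpush : (F.push q X : R4) = ∑ B, F.slash q X (e B) • F.push q (e B) :=
    he.isNullFrame.expansion_of_orthogonal (by simp) hXL hXLbar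
  refine F.immersion_ι q (hpush.trans ?_)
  simp only [map_sum, map_smul, push]

lemma sum_eq (he : F.IsFrame q e) {V : Type*} [AddCommGroup V] [Module ℝ V]
    (T : TangentSpace I q →ₗ[ℝ] TangentSpace I q →ₗ[ℝ] V) :
    ∑ A, T (F.e q A) (F.e q A) = ∑ A, T (e A) (e A) :=
  sum_contraction_eq (F.slash_symm q) (fun A ↦ he.expansion ((F.isFrame_e q).1 A))
    (fun A ↦ (F.isFrame_e q).expansion (he.1 A)) T

lemma tr_chibar (he : F.IsFrame q e) : F.tr F.chibar q = ∑ A, F.chibar q (e A) (e A) :=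
  he.sum_eq (F.chibarBilin q)

lemma sharp_eq (he : F.IsFrame q e) {ξ : (q : H) → TangentSpace I q → ℝ}
    (l : TangentSpace I q →ₗ[ℝ] ℝ) (hl : ∀ X, ξ q X = l X) :
    F.sharp ξ q = ∑ A, ξ q (e A) • e A := by
  simp only [sharp, hl]
  exact he.sum_eq ((LinearMap.lsmul ℝ (TangentSpace I q)).comp l)

end IsFrame

variable (F)

lemma slash_leafCov (W : (q : H) → TangentSpace I q) (q : H) (X : TangentSpace I q) (A : Fin 2) :
    F.slash q (F.leafCov W q X) (F.e q A) =
      g.inner (F.ι q) (F.D (fun q' ↦ F.push q' (W q')) q X) (F.push q (F.e q A)) := by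
  let e : Fin 2 → EuclideanSpace ℝ (Fin 3) := F.e q
  let c (B : Fin 2) : ℝ :=
    g.inner (F.ι q) (F.D (fun q' ↦ F.push q' (W q')) q X) (F.push q (F.e q B))
  have he (B : Fin 2) : F.slashBilin q (e B) (e A) = if B = A then 1 else 0 :=
    (F.isFrame_e q).2 B A
  change F.slashBilin q (∑ B, c B • e B) (e A) = c A
  simp only [map_sum, map_smul, sum_apply, smul_apply, he, smul_eq_mul, mul_ite, mul_one, mul_zero,
    Finset.sum_ite_eq', Finset.mem_univ, if_true]

lemma div_eq (ξ : (q : H) → TangentSpace I q → ℝ) (q : H) :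
    F.div ξ q = ∑ A, g.inner (F.ι q) (F.D (fun q' ↦ F.push q' (F.sharp ξ q')) q (F.e q A))
      (F.push q (F.e q A)) := by
  simp only [div, slash_leafCov]

lemma dot₂_hat (q : H) :
    F.dot₂ (F.hat F.chi) (F.hat F.chibar) q =
      F.dot₂ F.chi F.chibar q - 1 / 2 * F.tr F.chi q * F.tr F.chibar q := by
  simp only [dot₂, hat, tr, Fin.sum_univ_two, (F.isFrame_e q).2, Fin.isValue, if_true, zero_ne_one,
    one_ne_zero, if_false]
  ring

end NullFoliation

lemma contDiffOn_tangentCoordChange {E E' : Type*} [NormedAddCommGroup E] [NormedSpace ℝ E]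
    [NormedAddCommGroup E'] [NormedSpace ℝ E'] {K : Type*} [TopologicalSpace K]
    {J : ModelWithCorners ℝ E K} {N : Type*} [TopologicalSpace N] [ChartedSpace K N]
    [IsManifold J ∞ N] {U : Set E'} {f : E' → N} {Y : (y : E') → TangentSpace J (f y)} {x₀ : N}
    (hY : ContMDiffOn 𝓘(ℝ, E') J.tangent ∞ (fun y ↦ (⟨f y, Y y⟩ : TangentBundle J N)) U)
    (hf : Set.MapsTo f U (extChartAt J x₀).source) :
    ContDiffOn ℝ ∞ (fun y ↦ tangentCoordChange J (f y) x₀ (f y) (Y y)) U := by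
  have htriv := (trivializationAt E (TangentSpace J : N → Type _) x₀).contMDiffOn (n := ∞) (IB := J)
  rw [extChartAt_source] at hf
  exact contMDiffOn_iff_contDiffOn.mp
    (contMDiff_snd.comp_contMDiffOn (htriv.comp hY fun _ hy ↦ hf hy))

lemma contDiffOn_bilinearComp {E F E' : Type*} [NormedAddCommGroup E] [NormedSpace ℝ E]
    [FiniteDimensional ℝ E] [NormedAddCommGroup F] [NormedSpace ℝ F] [NormedAddCommGroup E']
    [NormedSpace ℝ E'] {n : WithTop ℕ∞} {U : Set E'} {G : E' → F →L[ℝ] F →L[ℝ] ℝ}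
    {A : E' → E →L[ℝ] F} (hG : ContDiffOn ℝ n G U) (hA : ContDiffOn ℝ n A U) :
    ContDiffOn ℝ n (fun y ↦ (G y).bilinearComp (A y) (A y)) U :=
  contDiffOn_clm_apply.mpr fun _ ↦ contDiffOn_clm_apply.mpr fun _ ↦
    (hG.clm_apply (hA.clm_apply contDiffOn_const)).clm_apply (hA.clm_apply contDiffOn_const)

namespace NullFoliation

variable {M : Type*} [TopologicalSpace M] [ChartedSpace R4 M] [IsManifold (𝓡 4) ∞ M]
  {g : LorentzMetric M}
  {K : Type*} [TopologicalSpace K] {I : ModelWithCorners ℝ (EuclideanSpace ℝ (Fin 3)) K}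
  {H : Type*} [TopologicalSpace H] [ChartedSpace K H] [IsManifold I ∞ H]
  (F : NullFoliation g I H) (q₀ : H)

/-- The part of the preferred chart around `q₀` that is mapped to the preferred chart around
`ι q₀`. -/
def coordDomain : Set (EuclideanSpace ℝ (Fin 3)) :=
  (extChartAt I q₀).target ∩
    (extChartAt I q₀).symm ⁻¹' (F.ι ⁻¹' (extChartAt (𝓡 4) (F.ι q₀)).source)

/-- The immersion `ι` in the preferred charts around `q₀` and `ι q₀`. -/
def coordMap (y : EuclideanSpace ℝ (Fin 3)) : R4 :=
  extChartAt (𝓡 4) (F.ι q₀) (F.ι ((extChartAt I q₀).symm y))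

/-- The generator `L` in the preferred chart around `q₀`. -/
def coordL (y : EuclideanSpace ℝ (Fin 3)) : EuclideanSpace ℝ (Fin 3) :=
  tangentCoordChange I ((extChartAt I q₀).symm y) q₀ ((extChartAt I q₀).symm y)
    (F.L ((extChartAt I q₀).symm y))

/-- The null normal `Lbar` in the preferred charts around `q₀` and `ι q₀`. -/
def coordLbar (y : EuclideanSpace ℝ (Fin 3)) : R4 :=
  tangentCoordChange (𝓡 4) (F.ι ((extChartAt I q₀).symm y)) (F.ι q₀)
    (F.ι ((extChartAt I q₀).symm y)) (F.Lbar ((extChartAt I q₀).symm y))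

/-- The function `v` in the preferred chart around `q₀`. -/
def coordV (y : EuclideanSpace ℝ (Fin 3)) : ℝ := F.v ((extChartAt I q₀).symm y)

lemma isChartDomain_coordDomain : IsChartDomain I q₀ (F.coordDomain q₀) where
  subset_target := Set.inter_subset_left
  mem_nhdsWithin {y} hy := by
    have hcont : ContinuousWithinAt (F.ι ∘ (extChartAt I q₀).symm) (Set.range I) y :=
      F.contMDiff_ι.continuous.continuousAt.comp_continuousWithinAt
        (mdifferentiableWithinAt_extChartAt_symm hy.1).continuousWithinAt
    exact Filter.inter_mem (extChartAt_target_mem_nhdsWithin_of_mem hy.1)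
      (hcont (extChartAt_source_mem_nhds' hy.2))

lemma mem_coordDomain : extChartAt I q₀ q₀ ∈ F.coordDomain q₀ := by
  refine ⟨mem_extChartAt_target q₀, ?_⟩
  simp only [Set.mem_preimage, extChartAt_to_inv]
  exact mem_extChartAt_source _

lemma contMDiffOn_symm_coordDomain :
    ContMDiffOn 𝓘(ℝ, EuclideanSpace ℝ (Fin 3)) I ∞ (extChartAt I q₀).symm (F.coordDomain q₀) :=
  (contMDiffOn_extChartAt_symm q₀).mono Set.inter_subset_left

lemma contDiffOn_coordMap : ContDiffOn ℝ ∞ (F.coordMap q₀) (F.coordDomain q₀) := by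
  rw [← contMDiffOn_iff_contDiffOn]
  refine (contMDiffOn_extChartAt (I := 𝓡 4) (x := F.ι q₀)).comp
    (F.contMDiff_ι.comp_contMDiffOn (F.contMDiffOn_symm_coordDomain q₀)) fun y hy ↦ ?_
  rw [← extChartAt_source (𝓡 4)]
  exact hy.2

lemma contDiffOn_coordL : ContDiffOn ℝ ∞ (F.coordL q₀) (F.coordDomain q₀) :=
  contDiffOn_tangentCoordChange
    (F.contMDiff_L.comp_contMDiffOn (F.contMDiffOn_symm_coordDomain q₀))
    fun _ hy ↦ (extChartAt I q₀).map_target hy.1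

lemma contDiffOn_coordLbar : ContDiffOn ℝ ∞ (F.coordLbar q₀) (F.coordDomain q₀) :=
  contDiffOn_tangentCoordChange
    (F.contMDiff_Lbar.comp_contMDiffOn (F.contMDiffOn_symm_coordDomain q₀)) fun _ hy ↦ hy.2

lemma contDiffOn_coordV : ContDiffOn ℝ ∞ (F.coordV q₀) (F.coordDomain q₀) := by
  rw [← contMDiffOn_iff_contDiffOn]
  exact F.contMDiff_v.comp_contMDiffOn (F.contMDiffOn_symm_coordDomain q₀)

/-- `U` is a relatively open part of the coordinate domain around `q₀`. -/
structure IsCoordDomain (U : Set (EuclideanSpace ℝ (Fin 3))) : Prop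
    extends IsChartDomain I q₀ U where
  subset_coordDomain : U ⊆ F.coordDomain q₀

variable {F q₀} {U : Set (EuclideanSpace ℝ (Fin 3))} {q : H}

lemma coordMap_eq (hq : q ∈ (extChartAt I q₀).source) :
    F.coordMap q₀ (extChartAt I q₀ q) = extChartAt (𝓡 4) (F.ι q₀) (F.ι q) := by
  rw [coordMap, (extChartAt I q₀).left_inv hq]

lemma coordL_eq (hq : q ∈ (extChartAt I q₀).source) :
    F.coordL q₀ (extChartAt I q₀ q) = tangentCoordChange I q q₀ q (F.L q) := by
  rw [coordL, (extChartAt I q₀).left_inv hq]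

lemma coordLbar_eq (hq : q ∈ (extChartAt I q₀).source) :
    F.coordLbar q₀ (extChartAt I q₀ q) =
      tangentCoordChange (𝓡 4) (F.ι q) (F.ι q₀) (F.ι q) (F.Lbar q) := by
  rw [coordLbar, (extChartAt I q₀).left_inv hq]

namespace IsCoordDomain

lemma exists_eq (hU : F.IsCoordDomain q₀ U) {y : EuclideanSpace ℝ (Fin 3)} (hy : y ∈ U) :
    ∃ q ∈ (extChartAt I q₀).source, extChartAt I q₀ q = y :=
  ⟨_, (extChartAt I q₀).map_target (hU.subset_target hy),
    (extChartAt I q₀).right_inv (hU.subset_target hy)⟩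

lemma inter (hU : F.IsCoordDomain q₀ U) {V : Set (EuclideanSpace ℝ (Fin 3))} (hV : IsOpen V) :
    F.IsCoordDomain q₀ (U ∩ V) where
  subset_target := Set.inter_subset_left.trans hU.subset_target
  mem_nhdsWithin hy := Filter.inter_mem (hU.mem_nhdsWithin hy.1)
    (mem_nhdsWithin_of_mem_nhds (hV.mem_nhds hy.2))
  subset_coordDomain := Set.inter_subset_left.trans hU.subset_coordDomain

lemma contDiffOn_coordMap (hU : F.IsCoordDomain q₀ U) : ContDiffOn ℝ ∞ (F.coordMap q₀) U :=
  (F.contDiffOn_coordMap q₀).mono hU.subset_coordDomain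

lemma contDiffOn_coordL (hU : F.IsCoordDomain q₀ U) : ContDiffOn ℝ ∞ (F.coordL q₀) U :=
  (F.contDiffOn_coordL q₀).mono hU.subset_coordDomain

lemma contDiffOn_coordLbar (hU : F.IsCoordDomain q₀ U) : ContDiffOn ℝ ∞ (F.coordLbar q₀) U :=
  (F.contDiffOn_coordLbar q₀).mono hU.subset_coordDomain

lemma contDiffOn_coordV (hU : F.IsCoordDomain q₀ U) : ContDiffOn ℝ ∞ (F.coordV q₀) U :=
  (F.contDiffOn_coordV q₀).mono hU.subset_coordDomain

lemma contDiffOn_push (hU : F.IsCoordDomain q₀ U)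
    {X : EuclideanSpace ℝ (Fin 3) → EuclideanSpace ℝ (Fin 3)} (hX : ContDiffOn ℝ ∞ X U) :
    ContDiffOn ℝ ∞ (fun y ↦ fderivWithin ℝ (F.coordMap q₀) U y (X y)) U :=
  (hU.contDiffOn_coordMap.fderivWithin hU.uniqueDiffOn (by simp)).clm_apply hX

lemma isCoordRepAt (hU : F.IsCoordDomain q₀ U) (hq : q ∈ (extChartAt I q₀).source)
    (hqU : extChartAt I q₀ q ∈ U) :
    IsCoordRepAt I F.ι q₀ (F.ι q₀) U (F.coordMap q₀) q where
  isChartDomain := hU.toIsChartDomain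
  mem_source := hq
  extChartAt_mem := hqU
  map_mem_source := by
    have hmem := (hU.subset_coordDomain hqU).2
    rwa [Set.mem_preimage, (extChartAt I q₀).left_inv hq] at hmem
  mdifferentiableAt := F.contMDiff_ι.mdifferentiableAt (by simp)
  differentiableWithinAt := hU.contDiffOn_coordMap.differentiableOn (by simp) _ hqU
  eventually_eq := by
    filter_upwards [extChartAt_source_mem_nhds' hq] with q' hq' using (coordMap_eq hq').symm

lemma push_eq (hU : F.IsCoordDomain q₀ U) (hq : q ∈ (extChartAt I q₀).source)
    (hqU : extChartAt I q₀ q ∈ U) (X : TangentSpace I q) :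
    tangentCoordChange (𝓡 4) (F.ι q) (F.ι q₀) (F.ι q) (F.push q X) =
      fderivWithin ℝ (F.coordMap q₀) U (extChartAt I q₀ q) (tangentCoordChange I q q₀ q X) :=
  (hU.isCoordRepAt hq hqU).tangentCoordChange_mfderiv X

lemma push_L (hU : F.IsCoordDomain q₀ U) (hq : q ∈ (extChartAt I q₀).source)
    (hqU : extChartAt I q₀ q ∈ U) :
    tangentCoordChange (𝓡 4) (F.ι q) (F.ι q₀) (F.ι q) (F.push q (F.L q)) =
      fderivWithin ℝ (F.coordMap q₀) U (extChartAt I q₀ q) (F.coordL q₀ (extChartAt I q₀ q)) := by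
  rw [coordL_eq hq]
  exact hU.push_eq hq hqU (F.L q)

lemma D_eq (hU : F.IsCoordDomain q₀ U) (hq : q ∈ (extChartAt I q₀).source)
    (hqU : extChartAt I q₀ q ∈ U) {Y : (q : H) → TangentSpace (𝓡 4) (F.ι q)}
    {Y' : EuclideanSpace ℝ (Fin 3) → R4} (hY' : ContDiffOn ℝ ∞ Y' U)
    (hY : ∀ q ∈ (extChartAt I q₀).source, extChartAt I q₀ q ∈ U →
      tangentCoordChange (𝓡 4) (F.ι q) (F.ι q₀) (F.ι q) (Y q) = Y' (extChartAt I q₀ q))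
    (X : TangentSpace I q) :
    tangentCoordChange (𝓡 4) (F.ι q) (F.ι q₀) (F.ι q) (F.D Y q X) =
      localCov (g.symbol (F.ι q₀)) (F.coordMap q₀) U Y' (extChartAt I q₀ q)
        (tangentCoordChange I q q₀ q X) :=
  (hU.isCoordRepAt hq hqU).tangentCoordChange_covAlong g
    (hY'.differentiableOn (by simp) _ hqU)
    ((hU.eventually_mem hq hqU).mono fun q' h ↦ hY q' h.1 h.2) X

lemma D_L (hU : F.IsCoordDomain q₀ U) (hq : q ∈ (extChartAt I q₀).source)
    (hqU : extChartAt I q₀ q ∈ U) (X : TangentSpace I q) :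
    tangentCoordChange (𝓡 4) (F.ι q) (F.ι q₀) (F.ι q)
        (F.D (fun q' ↦ F.push q' (F.L q')) q X) =
      localCov (g.symbol (F.ι q₀)) (F.coordMap q₀) U
        (fun y ↦ fderivWithin ℝ (F.coordMap q₀) U y (F.coordL q₀ y)) (extChartAt I q₀ q)
        (tangentCoordChange I q q₀ q X) :=
  hU.D_eq hq hqU (hU.contDiffOn_push hU.contDiffOn_coordL) (fun _ ↦ hU.push_L) X

lemma D_Lbar (hU : F.IsCoordDomain q₀ U) (hq : q ∈ (extChartAt I q₀).source)
    (hqU : extChartAt I q₀ q ∈ U) (X : TangentSpace I q) :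
    tangentCoordChange (𝓡 4) (F.ι q) (F.ι q₀) (F.ι q) (F.D F.Lbar q X) =
      localCov (g.symbol (F.ι q₀)) (F.coordMap q₀) U (F.coordLbar q₀) (extChartAt I q₀ q)
        (tangentCoordChange I q q₀ q X) :=
  hU.D_eq hq hqU hU.contDiffOn_coordLbar (fun _ hq _ ↦ (coordLbar_eq hq).symm) X

lemma inner_eq (hU : F.IsCoordDomain q₀ U) (hq : q ∈ (extChartAt I q₀).source)
    (hqU : extChartAt I q₀ q ∈ U) (u w : TangentSpace (𝓡 4) (F.ι q)) {u' w' : R4}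
    (hu : tangentCoordChange (𝓡 4) (F.ι q) (F.ι q₀) (F.ι q) u = u')
    (hw : tangentCoordChange (𝓡 4) (F.ι q) (F.ι q₀) (F.ι q) w = w') :
    g.inner (F.ι q) u w = g.inChart (F.ι q₀) (F.coordMap q₀ (extChartAt I q₀ q)) u' w' := by
  rw [coordMap_eq hq, ← hu, ← hw]
  exact (g.inChart_tangentCoordChange (F.ι q₀) (hU.isCoordRepAt hq hqU).map_mem_source u w).symm

lemma slash_eq (hU : F.IsCoordDomain q₀ U) (hq : q ∈ (extChartAt I q₀).source)
    (hqU : extChartAt I q₀ q ∈ U) (X Y : TangentSpace I q) :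
    F.slash q X Y = g.inChart (F.ι q₀) (F.coordMap q₀ (extChartAt I q₀ q))
      (fderivWithin ℝ (F.coordMap q₀) U (extChartAt I q₀ q) (tangentCoordChange I q q₀ q X))
      (fderivWithin ℝ (F.coordMap q₀) U (extChartAt I q₀ q) (tangentCoordChange I q q₀ q Y)) :=
  hU.inner_eq hq hqU _ _ (hU.push_eq hq hqU X) (hU.push_eq hq hqU Y)

lemma mdifferentiableAt_and_dirDeriv_eq (hU : F.IsCoordDomain q₀ U)
    (hq : q ∈ (extChartAt I q₀).source) (hqU : extChartAt I q₀ q ∈ U) {h : H → ℝ}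
    {h' : EuclideanSpace ℝ (Fin 3) → ℝ} (hh' : ContDiffOn ℝ ∞ h' U)
    (hh : ∀ q ∈ (extChartAt I q₀).source, extChartAt I q₀ q ∈ U → h q = h' (extChartAt I q₀ q)) :
    MDifferentiableAt I 𝓘(ℝ, ℝ) h q ∧ ∀ X : TangentSpace I q, dirDeriv I h q X =
      fderivWithin ℝ h' U (extChartAt I q₀ q) (tangentCoordChange I q q₀ q X) := by
  have hderiv := hU.hasMFDerivAt hq hqU (hh'.differentiableOn (by simp) _ hqU)
    ((hU.eventually_mem hq hqU).mono fun q' h ↦ hh q' h.1 h.2)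
  refine ⟨hderiv.mdifferentiableAt, fun X ↦ ?_⟩
  rw [dirDeriv, hderiv.mfderiv]
  rfl

lemma dirDeriv_v (hU : F.IsCoordDomain q₀ U) (hq : q ∈ (extChartAt I q₀).source)
    (hqU : extChartAt I q₀ q ∈ U) (X : TangentSpace I q) :
    dirDeriv I F.v q X = fderivWithin ℝ (F.coordV q₀) U (extChartAt I q₀ q)
      (tangentCoordChange I q q₀ q X) :=
  (hU.mdifferentiableAt_and_dirDeriv_eq hq hqU hU.contDiffOn_coordV (fun q hq _ ↦ by
    rw [coordV, (extChartAt I q₀).left_inv hq])).2 X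

variable {y : EuclideanSpace ℝ (Fin 3)}

lemma exists_push_eq (hU : F.IsCoordDomain q₀ U) (hy : y ∈ U) (X : EuclideanSpace ℝ (Fin 3)) :
    ∃ q ∈ (extChartAt I q₀).source, extChartAt I q₀ q = y ∧ ∃ X' : TangentSpace I q,
      tangentCoordChange I q q₀ q X' = X ∧
      tangentCoordChange (𝓡 4) (F.ι q) (F.ι q₀) (F.ι q) (F.push q X') =
        fderivWithin ℝ (F.coordMap q₀) U y X := by
  obtain ⟨q, hq, rfl⟩ := hU.exists_eq hy
  have hX := tangentCoordChange_leftInverse hq (mem_extChartAt_source (I := I) q) X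
  let X' : TangentSpace I q := tangentCoordChange I q₀ q q X
  exact ⟨q, hq, rfl, X', hX, (hU.push_eq hq hy X').trans (congrArg _ hX)⟩

lemma injective_fderivWithin_coordMap (hU : F.IsCoordDomain q₀ U) (hy : y ∈ U) :
    Function.Injective (fderivWithin ℝ (F.coordMap q₀) U y) := by
  rw [injective_iff_map_eq_zero]
  intro X hX
  obtain ⟨q, hq, rfl, X', rfl, hpush⟩ := hU.exists_push_eq hy X
  have hback := tangentCoordChange_leftInverse (mem_extChartAt_source (I := 𝓡 4) (F.ι q))
    (hU.isCoordRepAt hq hy).map_mem_source (F.push q X')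
  rw [hpush, hX, map_zero] at hback
  have hX' : X' = 0 := F.immersion_ι q (hback.symm.trans (map_zero _).symm)
  exact (congrArg (tangentCoordChange I q q₀ q) hX').trans (map_zero _)

lemma inChart_L_push (hU : F.IsCoordDomain q₀ U) (hy : y ∈ U) (X : EuclideanSpace ℝ (Fin 3)) :
    g.inChart (F.ι q₀) (F.coordMap q₀ y) (fderivWithin ℝ (F.coordMap q₀) U y (F.coordL q₀ y))
      (fderivWithin ℝ (F.coordMap q₀) U y X) = 0 := by
  obtain ⟨q, hq, rfl, X', -, hpush⟩ := hU.exists_push_eq hy X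
  exact (hU.inner_eq hq hy _ _ (hU.push_L hq hy) hpush).symm.trans (F.L_orthogonal q X')

lemma localCov_L_L (hU : F.IsCoordDomain q₀ U) (hy : y ∈ U) :
    localCov (g.symbol (F.ι q₀)) (F.coordMap q₀) U
      (fun y ↦ fderivWithin ℝ (F.coordMap q₀) U y (F.coordL q₀ y)) y (F.coordL q₀ y) = 0 := by
  obtain ⟨q, hq, rfl⟩ := hU.exists_eq hy
  rw [coordL_eq hq, ← hU.D_L hq hy]
  exact (congrArg (tangentCoordChange (𝓡 4) (F.ι q) (F.ι q₀) (F.ι q))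
    (F.L_geodesic q)).trans (map_zero _)

lemma inChart_push_Lbar (hU : F.IsCoordDomain q₀ U) (hy : y ∈ U) {X : EuclideanSpace ℝ (Fin 3)}
    (hX : fderivWithin ℝ (F.coordV q₀) U y X = 0) :
    g.inChart (F.ι q₀) (F.coordMap q₀ y) (fderivWithin ℝ (F.coordMap q₀) U y X)
      (F.coordLbar q₀ y) = 0 := by
  obtain ⟨q, hq, rfl, X', hX', hpush⟩ := hU.exists_push_eq hy X
  rw [← hX', ← hU.dirDeriv_v hq hy] at hX
  exact (hU.inner_eq hq hy _ _ hpush (coordLbar_eq hq).symm).symm.trans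
    ((g.symm _ _ _).trans (F.Lbar_orthogonal q X' hX))

lemma fderivWithin_coordV_coordL_pos (hU : F.IsCoordDomain q₀ U) (hy : y ∈ U) :
    0 < fderivWithin ℝ (F.coordV q₀) U y (F.coordL q₀ y) := by
  obtain ⟨q, hq, rfl⟩ := hU.exists_eq hy
  rw [coordL_eq hq, ← hU.dirDeriv_v hq hy]
  exact F.lapse_pos q

lemma contDiffOn_inChart_bilinearComp (hU : F.IsCoordDomain q₀ U) :
    ContDiffOn ℝ ∞ (fun y ↦ (g.inChart (F.ι q₀) (F.coordMap q₀ y)).bilinearComp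
      (fderivWithin ℝ (F.coordMap q₀) U y) (fderivWithin ℝ (F.coordMap q₀) U y)) U :=
  contDiffOn_bilinearComp
    ((g.contDiffOn_inChart (F.ι q₀)).comp hU.contDiffOn_coordMap
      fun _ hy ↦ (extChartAt (𝓡 4) (F.ι q₀)).map_source (hU.subset_coordDomain hy).2)
    (hU.contDiffOn_coordMap.fderivWithin hU.uniqueDiffOn (by simp))

end IsCoordDomain

/-- A smooth orthonormal frame `e` of the leaves on a coordinate domain `U` around `q₀`, read in the
preferred chart and extending the orthonormal basis `F.e q₀`. -/
structure CoordFrame (F : NullFoliation g I H) (q₀ : H) where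
  U : Set (EuclideanSpace ℝ (Fin 3))
  isCoordDomain : F.IsCoordDomain q₀ U
  mem : extChartAt I q₀ q₀ ∈ U
  e : Fin 2 → EuclideanSpace ℝ (Fin 3) → EuclideanSpace ℝ (Fin 3)
  contDiffOn_e (A : Fin 2) : ContDiffOn ℝ ∞ (e A) U
  e_self (A : Fin 2) : e A (extChartAt I q₀ q₀) = F.e q₀ A
  v_e {y : EuclideanSpace ℝ (Fin 3)} (hy : y ∈ U) (A : Fin 2) :
    fderivWithin ℝ (F.coordV q₀) U y (e A y) = 0
  e_e {y : EuclideanSpace ℝ (Fin 3)} (hy : y ∈ U) (A B : Fin 2) :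
    g.inChart (F.ι q₀) (F.coordMap q₀ y) (fderivWithin ℝ (F.coordMap q₀) U y (e A y))
      (fderivWithin ℝ (F.coordMap q₀) U y (e B y)) = if A = B then 1 else 0

/-- The foliation read in the preferred charts around `q₀` and `ι q₀`. -/
def CoordFrame.toLocal (C : F.CoordFrame q₀) :
    LocalNullFoliation (g.inChart (F.ι q₀)) (g.symbol (F.ι q₀)) (extChartAt (𝓡 4) (F.ι q₀)).target
      C.U (Fin 2) where
  f := F.coordMap q₀
  L := F.coordL q₀
  Lbar := F.coordLbar q₀
  v := F.coordV q₀
  e := C.e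
  leviCivita := g.isLeviCivitaOn (F.ι q₀)
  finrank_eq := by simp
  uniqueDiffOn := C.isCoordDomain.uniqueDiffOn
  subset_closure_interior := C.isCoordDomain.subset_closure_interior
  mapsTo y hy := (extChartAt (𝓡 4) (F.ι q₀)).map_source (C.isCoordDomain.subset_coordDomain hy).2
  contDiffOn_f := C.isCoordDomain.contDiffOn_coordMap
  contDiffOn_L := C.isCoordDomain.contDiffOn_coordL
  contDiffOn_Lbar := C.isCoordDomain.contDiffOn_coordLbar
  contDiffOn_v := C.isCoordDomain.contDiffOn_coordV
  contDiffOn_e := C.contDiffOn_e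
  injective := C.isCoordDomain.injective_fderivWithin_coordMap
  L_orthogonal := C.isCoordDomain.inChart_L_push
  geodesic := C.isCoordDomain.localCov_L_L
  Lbar_Lbar {y} hy := by
    obtain ⟨q, hq, rfl⟩ := C.isCoordDomain.exists_eq hy
    exact (C.isCoordDomain.inner_eq hq hy _ _ (coordLbar_eq hq).symm
      (coordLbar_eq hq).symm).symm.trans (F.Lbar_null q)
  L_Lbar {y} hy := by
    obtain ⟨q, hq, rfl⟩ := C.isCoordDomain.exists_eq hy
    exact (C.isCoordDomain.inner_eq hq hy _ _ (C.isCoordDomain.push_L hq hy)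
      (coordLbar_eq hq).symm).symm.trans (F.inner_L_Lbar q)
  e_Lbar {y} hy A := C.isCoordDomain.inChart_push_Lbar hy (C.v_e hy A)
  e_e := C.e_e
  v_e := C.v_e
  lapse_pos := C.isCoordDomain.fderivWithin_coordV_coordL_pos

variable (F q₀) in
lemma nonempty_coordFrame : Nonempty (F.CoordFrame q₀) := by
  have hW : F.IsCoordDomain q₀ (F.coordDomain q₀) := ⟨F.isChartDomain_coordDomain q₀, subset_rfl⟩
  have hq₀ := mem_extChartAt_source (I := I) q₀
  have hq₀W : extChartAt I q₀ q₀ ∈ F.coordDomain q₀ := F.mem_coordDomain q₀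
  let a (A : Fin 2) : EuclideanSpace ℝ (Fin 3) := tangentCoordChange I q₀ q₀ q₀ (F.e q₀ A)
  obtain ⟨V, e, hV, hq₀V, he, hea, hVe⟩ := exists_orthonormal_frame hq₀W
    hW.contDiffOn_inChart_bilinearComp
    ((F.contDiffOn_coordV q₀).fderivWithin hW.uniqueDiffOn (by simp)) (F.contDiffOn_coordL q₀)
    (fun y _ u w ↦ g.inChart_symm (F.ι q₀) (F.coordMap q₀ y) _ _)
    (fun _ hy ↦ (hW.fderivWithin_coordV_coordL_pos hy).ne') a
    (fun A ↦ (hW.dirDeriv_v hq₀ hq₀W (F.e q₀ A)).symm.trans ((F.isFrame_e q₀).1 A))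
    (fun A B ↦ (hW.slash_eq hq₀ hq₀W (F.e q₀ A) (F.e q₀ B)).symm.trans ((F.isFrame_e q₀).2 A B))
  exact ⟨{
    U := F.coordDomain q₀ ∩ V
    isCoordDomain := hW.inter hV
    mem := ⟨hq₀W, hq₀V⟩
    e := e
    contDiffOn_e := he
    e_self A := (hea A).trans (tangentCoordChange_self hq₀)
    v_e {y} hy A := by
      rw [fderivWithin_inter (hV.mem_nhds hy.2)]
      exact (hVe y hy).1 A
    e_e {y} hy A B := by
      rw [fderivWithin_inter (hV.mem_nhds hy.2)]
      exact (hVe y hy).2 A B }⟩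

namespace CoordFrame

variable (C : F.CoordFrame q₀)

/-- The coordinate frame as a frame of the tangent spaces of the leaves in `H`. -/
def frame (q : H) (A : Fin 2) : TangentSpace I q :=
  tangentCoordChange I q₀ q q (C.e A (extChartAt I q₀ q))

lemma frame_self : C.frame q₀ = F.e q₀ :=
  funext fun A ↦ (tangentCoordChange_self (mem_extChartAt_source (I := I) q₀)).trans (C.e_self A)

lemma tangentCoordChange_frame (hq : q ∈ (extChartAt I q₀).source) (A : Fin 2) :
    tangentCoordChange I q q₀ q (C.frame q A) = C.e A (extChartAt I q₀ q) :=
  tangentCoordChange_leftInverse hq (mem_extChartAt_source (I := I) q) _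

section Source

variable (hq : q ∈ (extChartAt I q₀).source) (hqU : extChartAt I q₀ q ∈ C.U)

include hq hqU

lemma tangentCoordChange_push_frame (A : Fin 2) :
    tangentCoordChange (𝓡 4) (F.ι q) (F.ι q₀) (F.ι q) (F.push q (C.frame q A)) =
      C.toLocal.pushE A (extChartAt I q₀ q) :=
  (C.isCoordDomain.push_eq hq hqU _).trans (congrArg _ (C.tangentCoordChange_frame hq A))

lemma isFrame : F.IsFrame q (C.frame q) := by
  constructor
  · intro A
    rw [C.isCoordDomain.dirDeriv_v hq hqU, C.tangentCoordChange_frame hq, C.v_e hqU]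
  · intro A B
    rw [C.isCoordDomain.slash_eq hq hqU, C.tangentCoordChange_frame hq,
      C.tangentCoordChange_frame hq, C.e_e hqU]

lemma chi_frame (A B : Fin 2) :
    F.chi q (C.frame q A) (C.frame q B) = C.toLocal.chi A B (extChartAt I q₀ q) :=
  C.isCoordDomain.inner_eq hq hqU _ _ ((C.isCoordDomain.D_L hq hqU _).trans
    (congrArg _ (C.tangentCoordChange_frame hq A))) (C.tangentCoordChange_push_frame hq hqU B)

lemma chibar_frame (A B : Fin 2) :
    F.chibar q (C.frame q A) (C.frame q B) = C.toLocal.chibar A B (extChartAt I q₀ q) :=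
  C.isCoordDomain.inner_eq hq hqU _ _ ((C.isCoordDomain.D_Lbar hq hqU _).trans
    (congrArg _ (C.tangentCoordChange_frame hq A))) (C.tangentCoordChange_push_frame hq hqU B)

lemma zeta_frame (A : Fin 2) :
    F.zeta q (C.frame q A) = C.toLocal.zeta A (extChartAt I q₀ q) :=
  congrArg (1 / 2 * ·) (C.isCoordDomain.inner_eq hq hqU _ _ ((C.isCoordDomain.D_L hq hqU _).trans
    (congrArg _ (C.tangentCoordChange_frame hq A))) (coordLbar_eq hq).symm)

lemma etabar_frame (A : Fin 2) :
    F.etabar q (C.frame q A) = C.toLocal.etabar A (extChartAt I q₀ q) :=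
  congrArg (1 / 2 * ·) (C.isCoordDomain.inner_eq hq hqU _ _
    ((C.isCoordDomain.D_Lbar hq hqU _).trans (congrArg _ (coordL_eq hq).symm))
    (C.tangentCoordChange_push_frame hq hqU A))

lemma lapse_eq : F.lapse q = C.toLocal.lapse (extChartAt I q₀ q) :=
  (C.isCoordDomain.dirDeriv_v hq hqU _).trans (congrArg _ (coordL_eq hq).symm)

lemma dirDeriv_log_lapse_frame (A : Fin 2) :
    dirDeriv I (fun q ↦ Real.log (F.lapse q)) q (C.frame q A) =
      C.toLocal.dlogLapse A (extChartAt I q₀ q) :=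
  ((C.isCoordDomain.mdifferentiableAt_and_dirDeriv_eq hq hqU C.toLocal.contDiffOn_log_lapse
    fun _ hq hqU ↦ congrArg Real.log (C.lapse_eq hq hqU)).2 _).trans
      (congrArg _ (C.tangentCoordChange_frame hq A))

lemma tr_chibar_eq :
    F.tr F.chibar q = ∑ A, C.toLocal.chibar A A (extChartAt I q₀ q) := by
  simp only [(C.isFrame hq hqU).tr_chibar, C.chibar_frame hq hqU]

lemma tangentCoordChange_push_sharp {ξ : (q : H) → TangentSpace I q → ℝ}
    {ξ' : Fin 2 → EuclideanSpace ℝ (Fin 3) → ℝ} (l : TangentSpace I q →ₗ[ℝ] ℝ)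
    (hl : ∀ X, ξ q X = l X) (hξ : ∀ A, ξ q (C.frame q A) = ξ' A (extChartAt I q₀ q)) :
    tangentCoordChange (𝓡 4) (F.ι q) (F.ι q₀) (F.ι q) (F.push q (F.sharp ξ q)) =
      C.toLocal.sharp ξ' (extChartAt I q₀ q) := by
  have sharp_frame : F.sharp ξ q = ∑ A, ξ' A (extChartAt I q₀ q) • C.frame q A := by
    simp only [(C.isFrame hq hqU).sharp_eq l hl, hξ]
  have push_sharp : (F.push q (F.sharp ξ q) : R4) =
      ∑ A, ξ' A (extChartAt I q₀ q) • (F.push q (C.frame q A) : R4) := by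
    rw [sharp_frame]
    exact (map_sum _ _ _).trans (Finset.sum_congr rfl fun A _ ↦ map_smul _ _ _)
  refine (congrArg _ push_sharp).trans ((map_sum _ _ _).trans (Finset.sum_congr rfl fun A _ ↦ ?_))
  exact (map_smul _ _ _).trans
    (congrArg (ξ' A (extChartAt I q₀ q) • ·) (C.tangentCoordChange_push_frame hq hqU A))

end Source

lemma coord_push_L_self :
    C.toLocal.pushL (extChartAt I q₀ q₀) = F.push q₀ (F.L q₀) :=
  (C.isCoordDomain.push_L (mem_extChartAt_source q₀) C.mem).symm.trans
    (tangentCoordChange_self (mem_extChartAt_source (F.ι q₀)))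

lemma coord_Lbar_self : C.toLocal.Lbar (extChartAt I q₀ q₀) = F.Lbar q₀ :=
  (coordLbar_eq (mem_extChartAt_source q₀)).trans
    (tangentCoordChange_self (mem_extChartAt_source (F.ι q₀)))

lemma div_eq {ξ : (q : H) → TangentSpace I q → ℝ} {ξ' : Fin 2 → EuclideanSpace ℝ (Fin 3) → ℝ}
    (l : (q : H) → TangentSpace I q →ₗ[ℝ] ℝ) (hl : ∀ q X, ξ q X = l q X)
    (hξ' : ∀ A, ContDiffOn ℝ ∞ (ξ' A) C.U)
    (hξ : ∀ q ∈ (extChartAt I q₀).source, extChartAt I q₀ q ∈ C.U → ∀ A,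
      ξ q (C.frame q A) = ξ' A (extChartAt I q₀ q)) :
    F.div ξ q₀ = C.toLocal.div ξ' (extChartAt I q₀ q₀) := by
  have hq₀ := mem_extChartAt_source (I := I) q₀
  rw [NullFoliation.div_eq, ← C.frame_self]
  refine Finset.sum_congr rfl fun A _ ↦ C.isCoordDomain.inner_eq hq₀ C.mem _ _ ?_
    (C.tangentCoordChange_push_frame hq₀ C.mem A)
  exact (C.isCoordDomain.D_eq hq₀ C.mem (C.toLocal.contDiffOn_sharp hξ')
    (fun q hq hqU ↦ C.tangentCoordChange_push_sharp hq hqU (l q) (hl q) (hξ q hq hqU)) _).trans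
      (congrArg _ (C.tangentCoordChange_frame hq₀ A))

lemma div_zeta : F.div F.zeta q₀ = C.toLocal.div C.toLocal.zeta (extChartAt I q₀ q₀) :=
  C.div_eq F.zetaLin (fun _ _ ↦ rfl) C.toLocal.contDiffOn_zeta fun _ ↦ C.zeta_frame

lemma laplacian_log_lapse :
    F.laplacian (fun q ↦ Real.log (F.lapse q)) q₀ =
      C.toLocal.div C.toLocal.dlogLapse (extChartAt I q₀ q₀) :=
  C.div_eq (fun q ↦ (mfderiv I 𝓘(ℝ, ℝ) (fun q ↦ Real.log (F.lapse q)) q).toLinearMap)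
    (fun _ _ ↦ rfl) C.toLocal.contDiffOn_dlogLapse fun _ ↦ C.dirDeriv_log_lapse_frame

lemma rho_eq :
    F.rho q₀ = 1 / 4 * g.inChart (F.ι q₀) (C.toLocal.f (extChartAt I q₀ q₀))
      (C.toLocal.Lbar (extChartAt I q₀ q₀))
      (localRiemann (g.symbol (F.ι q₀)) (C.toLocal.f (extChartAt I q₀ q₀))
        (C.toLocal.Lbar (extChartAt I q₀ q₀)) (C.toLocal.pushL (extChartAt I q₀ q₀))
        (C.toLocal.pushL (extChartAt I q₀ q₀))) := by
  have hq₀ := mem_extChartAt_source (I := I) q₀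
  have f_self : C.toLocal.f (extChartAt I q₀ q₀) = extChartAt (𝓡 4) (F.ι q₀) (F.ι q₀) :=
    coordMap_eq hq₀
  refine congrArg (1 / 4 * ·) (C.isCoordDomain.inner_eq hq₀ C.mem _ _ (coordLbar_eq hq₀).symm ?_)
  rw [f_self, C.coord_push_L_self, C.coord_Lbar_self]
  exact (tangentCoordChange_self (mem_extChartAt_source (F.ι q₀))).trans
    (g.riemann_eq (F.ι q₀) _ _ _)

lemma sum_localRiemann_eq :
    ∑ A, g.inChart (F.ι q₀) (C.toLocal.f (extChartAt I q₀ q₀))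
        (localRiemann (g.symbol (F.ι q₀)) (C.toLocal.f (extChartAt I q₀ q₀))
          (C.toLocal.pushL (extChartAt I q₀ q₀)) (C.toLocal.pushE A (extChartAt I q₀ q₀))
          (C.toLocal.Lbar (extChartAt I q₀ q₀)))
        (C.toLocal.pushE A (extChartAt I q₀ q₀)) =
      2 * F.rho q₀ - g.ricci (F.ι q₀) (F.push q₀ (F.L q₀)) (F.Lbar q₀) := by
  have f_self : C.toLocal.f (extChartAt I q₀ q₀) = extChartAt (𝓡 4) (F.ι q₀) (F.ι q₀) :=
    coordMap_eq (mem_extChartAt_source q₀)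
  have frame := C.toLocal.isNullFrame C.mem
  rw [C.rho_eq]
  rw [f_self] at frame ⊢
  rw [g.sum_localRiemann_eq (F.ι q₀) frame, C.coord_push_L_self, C.coord_Lbar_self]
  ring

end CoordFrame

end NullFoliation

theorem lemma2p4_general {M : Type*} [TopologicalSpace M] [ChartedSpace R4 M]
    [IsManifold (𝓡 4) ∞ M] (g : LorentzMetric M)
    {K : Type*} [TopologicalSpace K] (I : ModelWithCorners ℝ (EuclideanSpace ℝ (Fin 3)) K)
    {H : Type*} [TopologicalSpace H] [ChartedSpace K H] [IsManifold I ∞ H]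
    (F : NullFoliation g I H) (q : H) :
    MDifferentiableAt I 𝓘(ℝ, ℝ) (F.tr F.chibar) q ∧
      dirDeriv I (F.tr F.chibar) q (F.L q) + 1 / 2 * F.tr F.chi q * F.tr F.chibar q =
        2 * (F.rhoCheck q - F.div F.zeta q - F.laplacian (fun q ↦ Real.log (F.lapse q)) q)
          + 2 * F.normSq F.etabar q - g.ricci (F.ι q) (F.push q (F.L q)) (F.Lbar q) := by
  obtain ⟨C⟩ := F.nonempty_coordFrame q
  have hq := mem_extChartAt_source (I := I) q
  obtain ⟨hdiff, hderiv⟩ := C.isCoordDomain.mdifferentiableAt_and_dirDeriv_eq hq C.mem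
    (ContDiffOn.sum fun A _ ↦ C.toLocal.contDiffOn_chibar A A) fun _ ↦ C.tr_chibar_eq
  have transport : dirDeriv I (F.tr F.chibar) q (F.L q) =
      2 * (F.rho q - F.div F.zeta q - F.laplacian (fun q ↦ Real.log (F.lapse q)) q)
        - F.dot₂ F.chi F.chibar q + 2 * F.normSq F.etabar q
        - g.ricci (F.ι q) (F.push q (F.L q)) (F.Lbar q) := by
    rw [hderiv, ← NullFoliation.coordL_eq hq]
    refine (C.toLocal.transport_tr_chibar C.mem).trans ?_
    simp only [NullFoliation.dot₂, NullFoliation.normSq, ← C.frame_self, C.chi_frame hq C.mem,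
      C.chibar_frame hq C.mem, C.etabar_frame hq C.mem]
    rw [C.toLocal.div_etabar C.mem, C.sum_localRiemann_eq, C.div_zeta, C.laplacian_log_lapse]
    ring
  refine ⟨hdiff, ?_⟩
  rw [transport, NullFoliation.rhoCheck, F.dot₂_hat]
  ring

end

theorem lemma2p4 {M : Type*} [TopologicalSpace M] [ChartedSpace R4 M] [IsManifold (𝓡 4) ∞ M]
    (g : LorentzMetric M) (hg : g.IsVacuum)
    {K : Type*} [TopologicalSpace K] (I : ModelWithCorners ℝ (EuclideanSpace ℝ (Fin 3)) K)
    {H : Type*} [TopologicalSpace H] [ChartedSpace K H] [IsManifold I ∞ H]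
    (F : NullFoliation g I H) (hF : F.IsCanonical) (q : H) :
    MDifferentiableAt I 𝓘(ℝ, ℝ) (F.tr F.chibar) q ∧
      dirDeriv I (F.tr F.chibar) q (F.L q) + 1 / 2 * F.tr F.chi q * F.tr F.chibar q =
        2 * F.leafMean F.rhoCheck (F.v q) + 2 * F.normSq F.etabar q := by
  obtain ⟨hdiff, transport⟩ := lemma2p4_general g I F q
  exact ⟨hdiff, by
    linarith [hF.elliptic q, hg (F.ι q) (F.push q (F.L q)) (F.Lbar q)]⟩
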